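/- Let $c>0$, $\lambda>0$, let $V(0)$ be a random variable with $P\{V(0)=c\}=P\{V(0)=-c\}=\tfrac12$, and let $(N(t))_{t\ge 0}$ be a homogeneous Poisson process with rate $\lambda$, independent of $V(0)$. Let $$\mathcal T(t)=\int_0^t V(0)(-1)^{N(s)}\,ds,\qquad t\ge 0,$$ be the corresponding symmetric telegraph process. Fix $t>0$. Then $\max_{0\le s\le t}\mathcal T(s)$ is almost surely well defined (attained) and is a random variable, and the following hold. (i) For every integer $k\ge 1$, conditionally on $V(0)=-c$ and $N(t)=2k$, the maximum has on the interval $(0,ct)$ the density $$P\Bigl\{\max_{0\le s\le t}\mathcal T(s)\in d\beta \,\Big|\, V(0)=-c,\ N(t)=2k\Bigr\}=\frac{2\,(2k)!}{k!\,(k-1)!}\,\frac{(c^2t^2-\beta^2)^{k-1}(ct-\beta)}{(2ct)^{2k}}\,d\beta ,\qquad 0<\beta<ct,$$ that is, for every Borel set $B\subseteq(0,ct)$ the conditional probability that the maximum lies in $B$ is the integral of this function over $B$. (ii) For every integer $k\ge 0$, $$P\Bigl\{\max_{0\le s\le t}\mathcal T(s)=0 \,\Big|\, V(0)=-c,\ N(t)=2k\Bigr\}=\binom{2k}{k}\frac{1}{2^{2k}}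 .$$ -/

import Mathlib

open MeasureTheory ProbabilityTheory Set Filter Topology
open scoped NNReal ENNReal Nat

/-- `N` is a homogeneous Poisson process with rate `lam` on the probability space `(Ω, μ)`:
a counting process starting at `0`, with independent increments, such that `N t - N s` has the
Poisson distribution with parameter `lam * (t - s)` for `s ≤ t`, and such that almost every path is
nondecreasing and right-continuous. (As almost every path is nondecreasing, the truncated
subtraction of natural numbers is almost surely the true increment.) -/
structure IsPoissonProcess {Ω : Type*} [MeasurableSpace Ω] (μ : Measure Ω)
    (lam : ℝ≥0) (N : ℝ≥0 → Ω → ℕ) : Prop where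
  measurable : ∀ t, Measurable (N t)
  start_zero : ∀ᵐ ω ∂μ, N 0 ω = 0
  indep_increments : HasIndepIncrements N μ
  law_increment : ∀ s t : ℝ≥0, s ≤ t →
    HasLaw (fun ω => N t ω - N s ω) (poissonMeasure (lam * (t - s))) μ
  paths : ∀ᵐ ω ∂μ, Monotone (fun t => N t ω) ∧
    ∀ t, ContinuousWithinAt (fun s => N s ω) (Ici t) t

/-- The data driving a symmetric telegraph process with speed `c` and rate `lam`: an initial
velocity `V` equal to `c` or `-c` with probability `1/2` each, and a homogeneous Poisson process
`N` with rate `lam`, independent of `V` (as a whole process). -/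
structure IsTelegraphDriver {Ω : Type*} [MeasurableSpace Ω] (μ : Measure Ω)
    (c : ℝ) (lam : ℝ≥0) (V : Ω → ℝ) (N : ℝ≥0 → Ω → ℕ) : Prop where
  measurable_velocity : Measurable V
  velocity_pos : μ {ω | V ω = c} = 1 / 2
  velocity_neg : μ {ω | V ω = -c} = 1 / 2
  poisson : IsPoissonProcess μ lam N
  indep : IndepFun V (fun ω s => N s ω) μ

/-- The telegraph process `T(t) = ∫₀ᵗ V(0) (-1)^{N(s)} ds`. -/
noncomputable def telegraph {Ω : Type*} (V : Ω → ℝ) (N : ℝ≥0 → Ω → ℕ) (t : ℝ≥0) (ω : Ω) : ℝ :=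
  ∫ s in (0 : ℝ)..(t : ℝ), V ω * (-1 : ℝ) ^ N s.toNNReal ω

/-- The maximum over `0 ≤ s ≤ t` of a real process, as the supremum of the values. -/
noncomputable def runningMax {Ω : Type*} (X : ℝ≥0 → Ω → ℝ) (t : ℝ≥0) (ω : Ω) : ℝ :=
  sSup ((fun s => X s ω) '' Icc 0 t)

/-! Cut `[0, t]` into `m + 1` cells of length `h = t / (m + 1)` and freeze the velocity on each cell
at its value at the left end. Up to an event of probability at most `m (λh)² + λh`, each of the
first `m` cells contains at most one jump and the last contains none. The path is then a walk with
steps `±ch` coded by `m` bits saying where it turns. All bit sequences with `n` turns have the same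
probability `e^{-λt} (λh)^n`, so the law of the grid maximum is a counting problem.

The count is exact (`card_turnsBelow_eq_signedVandermonde`). For `a + b = m` and `b ≤ a`, the
sequences with `n` turns whose walk starts downwards and stays below `a + 1 - b` number `∑ sign (i +
1 - j) C(a,i) C(b,j)` over `i + j = n`. Conditioning on the first step and the first bit gives a
recursion that is Pascal's rule in `a` or in `b`.

Taking `a ≈ θm` with `θ = (ct + β) / (2ct)` sends the level to `β`, and the rescaled count to the
polynomial `signedBinomial` (`tendsto_signedVandermonde`). Almost surely the grid maximum converges
to the true one (`tendsto_gridMax`), which gives `P(M < β) ≤ F(β) ≤ P(M ≤ β)` on the conditioning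
event; continuity of `F` gives equality on the right (`measureReal_runningMax_le`).

For `n = 2k`, differentiating `F` produces differences of signs that vanish in all terms but one:
this is the density. At `β = 0` both arguments agree and terms with `i ≠ j` cancel in pairs: this is
the atom. -/

/-! ### Walks coded by turn sequences, and the first-step recursion for their number. -/

/-- The position after `j` unit steps of a walk with initial direction `ε` whose direction is
reversed `f l` times between the steps number `l` and `l + 1`. -/
def turnWalk (ε : ℤ) (f : ℕ → ℕ) (j : ℕ) : ℤ :=
  ∑ i ∈ Finset.range j, ε * (-1) ^ (∑ l ∈ Finset.range i, f l)

lemma turnWalk_zero (ε : ℤ) (f : ℕ → ℕ) : turnWalk ε f 0 = 0 := by simp [turnWalk]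

lemma turnWalk_succ (ε : ℤ) (f : ℕ → ℕ) (j : ℕ) :
    turnWalk ε f (j + 1) = ε + turnWalk (ε * (-1) ^ f 0) (fun l => f (l + 1)) j := by
  simp only [turnWalk]
  rw [Finset.sum_range_succ', add_comm]
  simp only [Finset.range_zero, Finset.sum_empty, pow_zero, mul_one, add_right_inj]
  refine Finset.sum_congr rfl fun i _ => ?_
  rw [Finset.sum_range_succ', pow_add]
  ring

lemma turnWalk_congr (ε : ℤ) {f g : ℕ → ℕ} {j : ℕ} (h : ∀ l, l + 1 < j → f l = g l) :
    turnWalk ε f j = turnWalk ε g j := by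
  refine Finset.sum_congr rfl fun i hi => ?_
  congr 2
  refine Finset.sum_congr rfl fun l hl => h l ?_
  simp only [Finset.mem_range] at hi hl
  omega

lemma turnWalk_le {ε : ℤ} (hε : ε = 1 ∨ ε = -1) (f : ℕ → ℕ) (j : ℕ) : turnWalk ε f j ≤ j := by
  have h : ∀ i ∈ Finset.range j, ε * (-1) ^ (∑ l ∈ Finset.range i, f l) ≤ 1 := by
    intro i _
    rcases hε with rfl | rfl <;>
    rcases neg_one_pow_eq_or ℤ (∑ l ∈ Finset.range i, f l) with h | h <;> simp [h]
  simpa [turnWalk] using Finset.sum_le_sum h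

/-- Extension by zero of a finite sequence of bits. -/
def bitSeq {m : ℕ} (f : Fin m → Bool) (l : ℕ) : ℕ := if h : l < m then (f ⟨l, h⟩).toNat else 0

lemma bitSeq_cons_zero {m : ℕ} (b : Bool) (f : Fin m → Bool) :
    bitSeq (Fin.cons b f : Fin (m + 1) → Bool) 0 = b.toNat := by
  simp only [bitSeq, Nat.zero_lt_succ, dif_pos]; rfl

lemma bitSeq_cons_succ {m : ℕ} (b : Bool) (f : Fin m → Bool) (l : ℕ) :
    bitSeq (Fin.cons b f : Fin (m + 1) → Bool) (l + 1) = bitSeq f l := by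
  simp only [bitSeq, Nat.add_lt_add_iff_right]
  split_ifs with h
  · rfl
  · rfl

/-- The turn sequences with `n` turns out of `m` possible ones whose walk stays below `J`. -/
def turnsBelow (ε : ℤ) (m n : ℕ) (J : ℤ) : Finset (Fin m → Bool) :=
  {f | ∑ l ∈ Finset.range m, bitSeq f l = n ∧ ∀ j ≤ m + 1, turnWalk ε (bitSeq f) j < J}

lemma card_filter_cons {m : ℕ} (p : (Fin (m + 1) → Bool) → Prop) [DecidablePred p] :
    Finset.card {f | p f} = Finset.card {f : Fin m → Bool | p (Fin.cons false f)} +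
      Finset.card {f : Fin m → Bool | p (Fin.cons true f)} := by
  simp only [Finset.card_filter]
  rw [← (Fin.consEquiv (fun _ : Fin (m + 1) => Bool)).sum_comp, Fintype.sum_prod_type,
    Fintype.sum_bool, add_comm]
  rfl

/-- Removing the first step shifts the level by `ε`. The shifted walk no longer sees the starting
point, which is why `0 < J` is needed. -/
lemma forall_turnWalk_cons {ε J : ℤ} (hJ : 0 < J) {m : ℕ} (b : Bool) (f : Fin m → Bool) :
    (∀ j ≤ m + 1 + 1, turnWalk ε (bitSeq (Fin.cons b f : Fin (m + 1) → Bool)) j < J) ↔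
      ∀ j ≤ m + 1, turnWalk (ε * (-1) ^ b.toNat) (bitSeq f) j < J - ε := by
  constructor
  · intro h j hj
    have := h (j + 1) (by omega)
    rw [turnWalk_succ] at this
    simp only [bitSeq_cons_succ, bitSeq_cons_zero] at this
    linarith
  · intro h j hj
    cases j with
    | zero => simpa [turnWalk_zero]
    | succ j =>
      rw [turnWalk_succ]
      simp only [bitSeq_cons_succ, bitSeq_cons_zero]
      linarith [h j (by omega)]

lemma card_turnsBelow_succ_zero {ε J : ℤ} (hJ : 0 < J) (m : ℕ) :
    (turnsBelow ε (m + 1) 0 J).card = (turnsBelow ε m 0 (J - ε)).card := by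
  rw [turnsBelow, card_filter_cons]
  simp only [forall_turnWalk_cons hJ, Finset.sum_range_succ', bitSeq_cons_zero, bitSeq_cons_succ]
  simp [turnsBelow]

lemma card_turnsBelow_succ_succ {ε J : ℤ} (hJ : 0 < J) (m n : ℕ) :
    (turnsBelow ε (m + 1) (n + 1) J).card =
      (turnsBelow ε m (n + 1) (J - ε)).card + (turnsBelow (-ε) m n (J - ε)).card := by
  rw [turnsBelow, card_filter_cons]
  simp only [forall_turnWalk_cons hJ, Finset.sum_range_succ', bitSeq_cons_zero, bitSeq_cons_succ]
  simp [turnsBelow]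

lemma card_turnsBelow_of_nonpos {ε J : ℤ} (hJ : J ≤ 0) (m n : ℕ) :
    (turnsBelow ε m n J).card = 0 := by
  simp only [turnsBelow, Finset.card_eq_zero, Finset.filter_eq_empty_iff, not_and]
  intro f _ _ h
  have := h 0 (by omega)
  rw [turnWalk_zero] at this
  omega

lemma card_turnsBelow_zero {ε J : ℤ} (n : ℕ)
    (h : ∀ f : Fin 0 → Bool, ∀ j ≤ 0 + 1, turnWalk ε (bitSeq f) j < J) :
    (turnsBelow ε 0 n J).card = Nat.choose 0 n := by
  have h' : ∀ f : Fin 0 → Bool, (∀ j ≤ 0 + 1, turnWalk ε (bitSeq f) j < J) ↔ True :=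
    fun f => iff_true_intro (h f)
  simp only [turnsBelow, h']
  cases n <;> simp

lemma card_turnsBelow_of_lt {ε J : ℤ} (hε : ε = 1 ∨ ε = -1) {m : ℕ} (n : ℕ) (hJ : (m : ℤ) + 1 < J) :
    (turnsBelow ε m n J).card = m.choose n := by
  induction m generalizing ε n J with
  | zero =>
    exact card_turnsBelow_zero n fun f j hj =>
      (turnWalk_le hε _ j).trans_lt (by push_cast at hJ; omega)
  | succ m ih =>
    have h1 : (m : ℤ) + 1 < J - ε := by push_cast at hJ; rcases hε with rfl | rfl <;> omega
    have h2 : -ε = 1 ∨ -ε = -1 := by rcases hε with rfl | rfl <;> simp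
    cases n with
    | zero => rw [card_turnsBelow_succ_zero (by omega), ih hε _ h1]; simp
    | succ n =>
      rw [card_turnsBelow_succ_succ (by omega), ih hε _ h1, ih h2 _ h1, Nat.choose_succ_succ',
        add_comm]

/-! ### Signed Vandermonde sums and the exact count. -/

/-- The signed Vandermonde sum `∑ sign (i + s - j) * C(a, i) * C(b, j)` over `i + j = n`. -/
def signedVandermonde (s : ℤ) (a b n : ℕ) : ℤ :=
  ∑ p ∈ Finset.HasAntidiagonal.antidiagonal n,
    ((p.1 : ℤ) + s - p.2).sign * (a.choose p.1 * b.choose p.2)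

lemma signedVandermonde_zero (s : ℤ) (a b : ℕ) : signedVandermonde s a b 0 = s.sign := by
  simp [signedVandermonde]

/-- Pascal's rule for `C(a + 1, i)`: in the part where `i` drops by one, the lost unit is absorbed
into `s`. -/
lemma signedVandermonde_succ_left (s : ℤ) (a b n : ℕ) :
    signedVandermonde s (a + 1) b (n + 1) =
      signedVandermonde s a b (n + 1) + signedVandermonde (s + 1) a b n := by
  simp only [signedVandermonde]
  rw [Finset.Nat.antidiagonal_succ, Finset.sum_cons, Finset.sum_cons, Finset.sum_map,
    Finset.sum_map, add_assoc, ← Finset.sum_add_distrib]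
  congr 1
  · simp
  refine Finset.sum_congr rfl fun p _ => ?_
  obtain ⟨i, j⟩ := p
  simp only [Function.Embedding.prodMap, Function.Embedding.coeFn_mk, Prod.map_apply,
    Function.Embedding.refl_apply, Nat.succ_eq_add_one, Nat.choose_succ_succ']
  push_cast
  rw [show (i : ℤ) + 1 + s - j = i + (s + 1) - j by ring]
  ring

lemma signedVandermonde_succ_right (s : ℤ) (a b n : ℕ) :
    signedVandermonde s a (b + 1) (n + 1) =
      signedVandermonde s a b (n + 1) + signedVandermonde (s - 1) a b n := by
  simp only [signedVandermonde]
  rw [Finset.Nat.antidiagonal_succ', Finset.sum_cons, Finset.sum_cons, Finset.sum_map,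
    Finset.sum_map, add_assoc, ← Finset.sum_add_distrib]
  congr 1
  · simp
  refine Finset.sum_congr rfl fun p _ => ?_
  obtain ⟨i, j⟩ := p
  simp only [Function.Embedding.prodMap, Function.Embedding.coeFn_mk, Prod.map_apply,
    Function.Embedding.refl_apply, Nat.succ_eq_add_one, Nat.choose_succ_succ']
  push_cast
  rw [show (i : ℤ) + s - (j + 1) = i + (s - 1) - j by ring]
  ring

/-- Exchanging `i` and `j` preserves the binomial weights when `a = b` and reverses the sign. -/
lemma signedVandermonde_self (a n : ℕ) : signedVandermonde 0 a a n = 0 := by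
  have h : signedVandermonde 0 a a n = -signedVandermonde 0 a a n := by
    conv_lhs => rw [signedVandermonde, ← Finset.Nat.sum_antidiagonal_swap]
    rw [signedVandermonde, ← Finset.sum_neg_distrib]
    refine Finset.sum_congr rfl fun p _ => ?_
    rw [show ((p.swap.1 : ℤ) + 0 - p.swap.2) = -(p.1 + 0 - p.2) by simp, Int.sign_neg]
    simp only [Prod.fst_swap, Prod.snd_swap]
    ring
  omega

lemma signedVandermonde_one_right_zero (a n : ℕ) : signedVandermonde 1 a 0 n = a.choose n := by
  rw [signedVandermonde, Finset.sum_eq_single (n, 0)]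
  · have : ((n : ℤ) + 1).sign = 1 := Int.sign_eq_one_of_pos (by omega)
    simp [this]
  · rintro ⟨i, j⟩ h1 h2
    rcases j with _ | j
    · simp_all
    · simp
  · simp

/-- An upward first step lowers `a` by one, a downward one lowers `b`; a turn exchanges the two
starting directions, that is, `s = 0` and `s = 1`. These are the two Pascal rules, so only the
boundary cases `a = b` (upwards) and `b = 0` (downwards) need a separate argument. -/
lemma card_turnsBelow_eq_signedVandermonde {m a b : ℕ} (n : ℕ) (hm : a + b = m) (hab : b ≤ a) :
    ((turnsBelow 1 m n ((a : ℤ) + 1 - b)).card : ℤ) = signedVandermonde 0 a b n ∧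
      ((turnsBelow (-1) m n ((a : ℤ) + 1 - b)).card : ℤ) = signedVandermonde 1 a b n := by
  induction m generalizing a b n with
  | zero =>
    obtain rfl : a = 0 := by omega
    obtain rfl : b = 0 := by omega
    rw [signedVandermonde_self, signedVandermonde_one_right_zero]
    have h1 : ∀ f : Fin 0 → Bool, turnWalk 1 (bitSeq f) 1 = 1 := by simp [turnWalk]
    have h2 : ∀ f : Fin 0 → Bool, turnWalk (-1) (bitSeq f) 1 = -1 := by simp [turnWalk]
    constructor
    · simp only [turnsBelow, Nat.cast_eq_zero, Finset.card_eq_zero, Finset.filter_eq_empty_iff]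
      rintro f - ⟨-, h⟩
      have := h 1 le_rfl
      rw [h1] at this
      simp at this
    · rw [Nat.cast_inj]
      refine card_turnsBelow_zero n fun f j hj => ?_
      interval_cases j
      · simp [turnWalk_zero]
      · rw [h2]; simp
  | succ m ih =>
    have hJ : (0 : ℤ) < (a : ℤ) + 1 - b := by omega
    constructor
    -- If `a = b` the level is `1` and the upward first step already reaches it.
    · rcases hab.eq_or_lt with rfl | hlt
      · rw [signedVandermonde_self, Nat.cast_eq_zero]
        have e : ((b : ℤ) + 1 - b - 1) ≤ 0 := by omega
        cases n with
        | zero => rw [card_turnsBelow_succ_zero hJ, card_turnsBelow_of_nonpos e]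
        | succ n =>
          rw [card_turnsBelow_succ_succ hJ, card_turnsBelow_of_nonpos e,
            card_turnsBelow_of_nonpos e]
      · obtain ⟨a, rfl⟩ : ∃ a', a = a' + 1 := ⟨a - 1, by omega⟩
        have e : (((a + 1 : ℕ) : ℤ) + 1 - b - 1) = (a : ℤ) + 1 - b := by push_cast; ring
        have ih' := fun n => ih (a := a) (b := b) n (by omega) (by omega)
        cases n with
        | zero =>
          rw [card_turnsBelow_succ_zero hJ, e, (ih' 0).1, signedVandermonde_zero,
            signedVandermonde_zero]
        | succ n =>
          rw [card_turnsBelow_succ_succ hJ, e, Nat.cast_add, (ih' _).1, (ih' _).2,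
            signedVandermonde_succ_left]
          simp
    -- If `b = 0` the level is out of reach after a downward first step, so every sequence with `n`
    -- turns counts.
    · cases b with
      | zero =>
        rw [signedVandermonde_one_right_zero, Nat.cast_inj]
        obtain rfl : a = m + 1 := by omega
        have e : (m : ℤ) + 1 < ((m + 1 : ℕ) : ℤ) + 1 - (0 : ℕ) - (-1) := by push_cast; omega
        cases n with
        | zero =>
          rw [card_turnsBelow_succ_zero hJ, card_turnsBelow_of_lt (by simp) _ e]; simp
        | succ n =>
          rw [card_turnsBelow_succ_succ hJ, card_turnsBelow_of_lt (by simp) _ e,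
            card_turnsBelow_of_lt (by simp) _ e, Nat.choose_succ_succ', add_comm]
      | succ b =>
        have e : ((a : ℤ) + 1 - (b + 1 : ℕ) - (-1)) = (a : ℤ) + 1 - b := by push_cast; ring
        have ih' := fun n => ih (a := a) (b := b) n (by omega) (by omega)
        cases n with
        | zero =>
          rw [card_turnsBelow_succ_zero hJ, e, (ih' 0).2, signedVandermonde_zero,
            signedVandermonde_zero]
        | succ n =>
          rw [card_turnsBelow_succ_succ hJ, e, Nat.cast_add, (ih' _).2, neg_neg, (ih' _).1,
            signedVandermonde_succ_right]
          simp

/-! ### Poisson increments on a grid and the law of the discretised path. -/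

/-- The increment of `N` over the `l`-th cell of the grid with mesh `h`. -/
def gridIncr {Ω : Type*} (N : ℝ≥0 → Ω → ℕ) (h : ℝ≥0) (l : ℕ) (ω : Ω) : ℕ :=
  N ((l + 1 : ℕ) * h) ω - N (l * h) ω

lemma sum_gridIncr {Ω : Type*} {N : ℝ≥0 → Ω → ℕ} {ω : Ω} (h0 : N 0 ω = 0)
    (hmono : Monotone fun t => N t ω) (h : ℝ≥0) (i : ℕ) :
    ∑ l ∈ Finset.range i, gridIncr N h l ω = N (i * h) ω := by
  have hm : Monotone fun l : ℕ => N ((l : ℝ≥0) * h) ω := fun a b hab =>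
    hmono (mul_le_mul_of_nonneg_right (Nat.cast_le.2 hab) (zero_le))
  have := Finset.sum_range_tsub hm i
  simp only [Nat.cast_zero, zero_mul, h0, tsub_zero] at this
  exact this

lemma poissonMeasure_real_Ici_one_le (r : ℝ≥0) : (poissonMeasure r).real (Ici 1) ≤ r := by
  have e : (Ici 1 : Set ℕ) = {0}ᶜ := by ext; simp [Nat.one_le_iff_ne_zero]
  rw [e, probReal_compl_eq_one_sub (by measurability), poissonMeasure_real_singleton]
  have := Real.add_one_le_exp (-(r : ℝ))
  simp only [pow_zero, mul_one, Nat.factorial_zero, Nat.cast_one, div_one]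
  linarith

lemma poissonMeasure_real_Ici_two_le (r : ℝ≥0) : (poissonMeasure r).real (Ici 2) ≤ r ^ 2 := by
  have e : (Ici 2 : Set ℕ) = ({0} ∪ {1})ᶜ := by ext x; simp; omega
  rw [e, probReal_compl_eq_one_sub (by measurability),
    measureReal_union (by simp) (by measurability), poissonMeasure_real_singleton,
    poissonMeasure_real_singleton]
  -- Gives `(1 - r) (1 + r) ≤ e^{-r} (1 + r)`, hence `1 - e^{-r} (1 + r) ≤ r²`.
  have := mul_le_mul_of_nonneg_right (Real.add_one_le_exp (-(r : ℝ)))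
    (by positivity : 0 ≤ 1 + (r : ℝ))
  simp only [pow_zero, mul_one, Nat.factorial_zero, Nat.cast_one, div_one, pow_one,
    Nat.factorial_one]
  nlinarith

lemma bitSeq_of_le {m l : ℕ} (f : Fin m → Bool) (h : m ≤ l) : bitSeq f l = 0 :=
  dif_neg (by omega)

lemma bitSeq_le_one {m : ℕ} (f : Fin m → Bool) (l : ℕ) : bitSeq f l ≤ 1 := by
  unfold bitSeq; split_ifs
  · exact Bool.toNat_le _
  · simp

lemma bitSeq_injective (m : ℕ) : Function.Injective (bitSeq : (Fin m → Bool) → ℕ → ℕ) := by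
  intro f g h
  ext i
  have := congrFun h i
  simp only [bitSeq, i.2, dif_pos] at this
  revert this
  cases f i <;> cases g i <;> simp

/-- The event that the first `m` cells contain at most one jump each, that the next cell contains
none, that there are `n` jumps, and that the discretised path stays below the level `J`. -/
def simpleJumps {Ω : Type*} (N : ℝ≥0 → Ω → ℕ) (h : ℝ≥0) (m n : ℕ) (J : ℤ) : Set Ω :=
  {ω | (∀ l < m, gridIncr N h l ω ≤ 1) ∧ gridIncr N h m ω = 0 ∧
    ∑ l ∈ Finset.range m, gridIncr N h l ω = n ∧
    ∀ j ≤ m + 1, turnWalk (-1) (fun l => gridIncr N h l ω) j < J}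

/-- With at most one jump per cell the increments are themselves a bit sequence, so the event splits
into cylinders. The last cell must be empty because a jump there turns none of the `m + 1` steps,
yet counts in the final value of `N`; its value `0` is the default of `bitSeq` at `m`. -/
lemma simpleJumps_eq {Ω : Type*} (N : ℝ≥0 → Ω → ℕ) (h : ℝ≥0) (m n : ℕ) (J : ℤ) :
    simpleJumps N h m n J = ⋃ f ∈ turnsBelow (-1) m n J,
      {ω | ∀ l ∈ Finset.range (m + 1), gridIncr N h l ω = bitSeq f l} := by
  ext ω
  simp only [simpleJumps, mem_ofPred_eq, mem_iUnion, exists_prop, turnsBelow, Finset.mem_filter,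
    Finset.mem_univ, true_and, Finset.mem_range]
  constructor
  · rintro ⟨h1, h2, h3, h4⟩
    have key : ∀ l < m + 1, gridIncr N h l ω =
        bitSeq (fun i : Fin m => decide (gridIncr N h i ω = 1)) l := by
      intro l hl
      rcases (Nat.lt_succ_iff.1 hl).eq_or_lt with rfl | hl
      · rw [h2, bitSeq_of_le _ le_rfl]
      · have := h1 l hl
        simp only [bitSeq, hl, dif_pos]
        interval_cases gridIncr N h l ω <;> simp
    refine ⟨_, ⟨?_, fun j hj => ?_⟩, key⟩
    · rw [← h3]
      exact Finset.sum_congr rfl fun l hl => (key l (by simp at hl; omega)).symm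
    · rw [← turnWalk_congr (-1) (fun l hl => key l (by omega))]
      exact h4 j hj
  · rintro ⟨f, ⟨h1, h2⟩, key⟩
    refine ⟨fun l hl => ?_, ?_, ?_, fun j hj => ?_⟩
    · rw [key l (by omega)]; exact bitSeq_le_one f l
    · rw [key m (by omega)]; exact bitSeq_of_le f le_rfl
    · rw [← h1]
      exact Finset.sum_congr rfl fun l hl => key l (by simp at hl; omega)
    · rw [turnWalk_congr (-1) (fun l hl => key l (by omega))]
      exact h2 j hj

section Grid

variable {Ω : Type*} [MeasurableSpace Ω] {μ : Measure Ω}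
  {lam : ℝ≥0} {N : ℝ≥0 → Ω → ℕ}

lemma IsPoissonProcess.hasLaw_gridIncr (hN : IsPoissonProcess μ lam N) (h : ℝ≥0) (l : ℕ) :
    HasLaw (gridIncr N h l) (poissonMeasure (lam * h)) μ := by
  have hle : (l : ℝ≥0) * h ≤ ((l + 1 : ℕ) : ℝ≥0) * h :=
    mul_le_mul_of_nonneg_right (Nat.cast_le.2 (Nat.le_succ l)) (zero_le)
  have hh : ((l + 1 : ℕ) : ℝ≥0) * h - l * h = h := by
    rw [← tsub_mul, Nat.cast_succ, add_tsub_cancel_left, one_mul]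
  have := hN.law_increment _ _ hle
  rwa [hh] at this

lemma IsPoissonProcess.measurable_gridIncr (hN : IsPoissonProcess μ lam N) (h : ℝ≥0) (l : ℕ) :
    Measurable (gridIncr N h l) :=
  (hN.measurable _).sub (hN.measurable _)

lemma IsPoissonProcess.iIndepFun_gridIncr (hN : IsPoissonProcess μ lam N) (h : ℝ≥0) :
    iIndepFun (gridIncr N h) μ :=
  hN.indep_increments.nat (t := fun l : ℕ => (l : ℝ≥0) * h) fun _ _ hab =>
    mul_le_mul_of_nonneg_right (Nat.cast_le.2 hab) (zero_le)

lemma IsPoissonProcess.measureReal_gridIncr_eq (hN : IsPoissonProcess μ lam N) (h : ℝ≥0) (m : ℕ)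
    (g : ℕ → ℕ) :
    μ.real {ω | ∀ l ∈ Finset.range m, gridIncr N h l ω = g l} =
      ∏ l ∈ Finset.range m, (Real.exp (-(lam * h)) * (lam * h) ^ g l / (g l)!) := by
  have e : {ω | ∀ l ∈ Finset.range m, gridIncr N h l ω = g l} =
      ⋂ l ∈ Finset.range m, gridIncr N h l ⁻¹' {g l} := by ext; simp
  rw [e, measureReal_def, (hN.iIndepFun_gridIncr h).measure_inter_preimage_eq_mul
    (Finset.range m) (sets := fun l => {g l}) (fun _ _ => by measurability), ENNReal.toReal_prod]
  refine Finset.prod_congr rfl fun l _ => ?_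
  change (μ {ω | gridIncr N h l ω ∈ ({g l} : Set ℕ)}).toReal = _
  rw [(hN.hasLaw_gridIncr h l).measure_eq (p := (· ∈ ({g l} : Set ℕ))) (by measurability)]
  have := poissonMeasure_real_singleton (lam * h) (g l)
  push_cast at this
  exact this

lemma IsPoissonProcess.measureReal_multiple_jumps_le (hN : IsPoissonProcess μ lam N)
    (h : ℝ≥0) (m : ℕ) :
    μ.real ((⋃ l ∈ Finset.range m, {ω | 2 ≤ gridIncr N h l ω}) ∪ {ω | 1 ≤ gridIncr N h m ω}) ≤
      m * (lam * h) ^ 2 + lam * h := by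
  refine (measureReal_union_le _ _).trans (add_le_add ?_ ?_)
  · refine (measureReal_biUnion_finset_le _ _).trans ?_
    rw [← nsmul_eq_mul, ← Finset.card_range m]
    simp only [Finset.card_range]
    conv_rhs => rw [← Finset.card_range m]
    refine Finset.sum_le_card_nsmul _ _ _ fun l _ => ?_
    rw [(hN.hasLaw_gridIncr h l).measureReal_eq (p := (2 ≤ ·)) (by measurability)]
    exact_mod_cast poissonMeasure_real_Ici_two_le (lam * h)
  · rw [(hN.hasLaw_gridIncr h m).measureReal_eq (p := (1 ≤ ·)) (by measurability)]
    exact_mod_cast poissonMeasure_real_Ici_one_le (lam * h)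

variable {c : ℝ} {V : Ω → ℝ}

lemma IsTelegraphDriver.measureReal_velocity_gridIncr_eq (hT : IsTelegraphDriver μ c lam V N)
    (h : ℝ≥0) (m : ℕ) (g : ℕ → ℕ) :
    μ.real ({ω | V ω = -c} ∩ {ω | ∀ l ∈ Finset.range m, gridIncr N h l ω = g l}) =
      1 / 2 * ∏ l ∈ Finset.range m, (Real.exp (-(lam * h)) * (lam * h) ^ g l / (g l)!) := by
  rw [← hT.poisson.measureReal_gridIncr_eq]
  let S : Set (ℝ≥0 → ℕ) := ⋂ l ∈ Finset.range m,
    {p | p ((l + 1 : ℕ) * h) - p (l * h) = g l}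
  have hS : MeasurableSet S := by
    refine Finset.measurableSet_biInter _ fun l _ => ?_
    have : Measurable fun p : ℝ≥0 → ℕ => p ((l + 1 : ℕ) * h) - p (l * h) :=
      (measurable_pi_apply _).sub (measurable_pi_apply _)
    exact this (measurableSet_singleton (g l))
  have e : {ω | ∀ l ∈ Finset.range m, gridIncr N h l ω = g l} = (fun ω s => N s ω) ⁻¹' S := by
    ext; simp [S, gridIncr]
  have := hT.indep.measure_inter_preimage_eq_mul {-c} S (by measurability) hS
  rw [e, measureReal_def, measureReal_def]
  change (μ (V ⁻¹' {-c} ∩ _)).toReal = _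
  rw [this, ENNReal.toReal_mul]
  congr 1
  have h2 := hT.velocity_neg
  change μ (V ⁻¹' {-c}) = _ at h2
  rw [h2]; simp

variable [IsProbabilityMeasure μ]

/-- Each cylinder has the same probability: the factorials of bits are `1`, and the exponents of
`λh` add up to the number of turns. -/
lemma IsTelegraphDriver.measureReal_velocity_simpleJumps (hT : IsTelegraphDriver μ c lam V N)
    (h : ℝ≥0) (m n : ℕ) (J : ℤ) :
    μ.real ({ω | V ω = -c} ∩ simpleJumps N h m n J) =
      1 / 2 * Real.exp (-(lam * ((m + 1 : ℕ) * h))) *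
        ((lam * h) ^ n * (turnsBelow (-1) m n J).card) := by
  rw [simpleJumps_eq, inter_iUnion₂, measureReal_biUnion_finset]
  · have key : ∀ f ∈ turnsBelow (-1) m n J, μ.real ({ω | V ω = -c} ∩
        {ω | ∀ l ∈ Finset.range (m + 1), gridIncr N h l ω = bitSeq f l}) =
        1 / 2 * Real.exp (-(lam * ((m + 1 : ℕ) * h))) * (lam * h) ^ n := by
      intro f hf
      have hfact : ∀ l, (bitSeq f l)! = 1 := fun l => by
        have := bitSeq_le_one f l
        interval_cases bitSeq f l <;> rfl
      rw [hT.measureReal_velocity_gridIncr_eq]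
      simp only [hfact, Nat.cast_one, div_one]
      rw [Finset.prod_mul_distrib, Finset.prod_pow_eq_pow_sum, Finset.sum_range_succ,
        bitSeq_of_le f le_rfl, Finset.prod_const, Finset.card_range, ← Real.exp_nat_mul,
        (Finset.mem_filter.1 hf).2.1, add_zero, mul_assoc]
      congr 3
      push_cast
      ring
    rw [Finset.sum_congr rfl key, Finset.sum_const, nsmul_eq_mul]
    ring
  · intro f _ g _ hfg
    refine Set.disjoint_left.2 fun ω h1 h2 => hfg (bitSeq_injective m ?_)
    ext l
    by_cases hl : l < m + 1
    · rw [← h1.2 l (by simpa using hl), h2.2 l (by simpa using hl)]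
    · rw [bitSeq_of_le f (by omega), bitSeq_of_le g (by omega)]
  · intro f _
    refine (hT.measurable_velocity (measurableSet_singleton _)).inter ?_
    simp only [ofPred_forall]
    exact Finset.measurableSet_biInter _ fun l _ =>
      hT.poisson.measurable_gridIncr h l (measurableSet_singleton _)

/-- The event that the velocity is `-c`, that there are `n` jumps up to time `(m + 1) * h` and that
the discretised path stays below the level `J`. -/
def discreteBelow (c : ℝ) (V : Ω → ℝ) (N : ℝ≥0 → Ω → ℕ) (h : ℝ≥0) (m n : ℕ) (J : ℤ) : Set Ω :=
  {ω | (V ω = -c ∧ N ((m + 1 : ℕ) * h) ω = n) ∧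
    ∀ j ≤ m + 1, turnWalk (-1) (fun l => gridIncr N h l ω) j < J}

/-- Almost surely the two events differ only on `bad`, whose probability is already bounded. -/
lemma IsTelegraphDriver.abs_measureReal_discreteBelow_sub_le
    (hT : IsTelegraphDriver μ c lam V N) (h : ℝ≥0) (m n : ℕ) (J : ℤ) :
    |μ.real (discreteBelow c V N h m n J) -
      1 / 2 * Real.exp (-(lam * ((m + 1 : ℕ) * h))) *
        ((lam * h) ^ n * (turnsBelow (-1) m n J).card)| ≤ m * (lam * h) ^ 2 + lam * h := by
  rw [← hT.measureReal_velocity_simpleJumps]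
  set bad : Set Ω :=
    (⋃ l ∈ Finset.range m, {ω | 2 ≤ gridIncr N h l ω}) ∪ {ω | 1 ≤ gridIncr N h m ω} with hbad
  have hb := hT.poisson.measureReal_multiple_jumps_le h m
  have h1 : discreteBelow c V N h m n J ≤ᵐ[μ]
      (({ω | V ω = -c} ∩ simpleJumps N h m n J) ∪ bad : Set Ω) := by
    filter_upwards [hT.poisson.start_zero, hT.poisson.paths] with ω h0 hp hω
    by_cases hB : ω ∈ bad
    · exact Or.inr hB
    refine Or.inl ⟨hω.1.1, ?_⟩
    simp only [hbad, mem_union, mem_iUnion, Finset.mem_range, mem_ofPred_eq, exists_prop, not_or,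
      not_exists, not_and, not_le] at hB
    have hsum := sum_gridIncr h0 hp.1 h (m + 1)
    have hm : gridIncr N h m ω = 0 := by omega
    rw [Finset.sum_range_succ, hm, add_zero, hω.1.2] at hsum
    exact ⟨fun l hl => by have := hB.1 l hl; omega, hm, hsum, hω.2⟩
  have h2 : ({ω | V ω = -c} ∩ simpleJumps N h m n J : Set Ω) ≤ᵐ[μ]
      discreteBelow c V N h m n J := by
    filter_upwards [hT.poisson.start_zero, hT.poisson.paths] with ω h0 hp hω
    refine ⟨⟨hω.1, ?_⟩, hω.2.2.2.2⟩
    rw [← sum_gridIncr h0 hp.1 h (m + 1), Finset.sum_range_succ, hω.2.2.1, add_zero]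
    exact hω.2.2.2.1
  have h1' : μ.real (discreteBelow c V N h m n J) ≤
      μ.real ({ω | V ω = -c} ∩ simpleJumps N h m n J) + μ.real bad :=
    (ENNReal.toReal_mono (measure_ne_top _ _) (measure_mono_ae h1)).trans
      (measureReal_union_le _ _)
  have h2' := ENNReal.toReal_mono (measure_ne_top μ _) (measure_mono_ae h2)
  rw [abs_le]
  simp only [measureReal_def] at *
  constructor <;> linarith [ENNReal.toReal_nonneg (a := μ bad)]

end Grid

/-! ### Left step functions and Riemann sums. -/

section StepFunction

variable {g : ℝ → ℝ} {K : ℝ}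

lemma intervalIntegrable_of_abs_le (hg : Measurable g) (hK : ∀ u, |g u| ≤ K) (a b : ℝ) :
    IntervalIntegrable g volume a b :=
  (intervalIntegrable_const (c := K)).mono_fun hg.aestronglyMeasurable
    (ae_of_all _ fun u => by simpa using (hK u).trans (le_abs_self K))

/-- The step function with mesh `h` which interpolates `g` from the left. -/
noncomputable def leftStep (g : ℝ → ℝ) (h : ℝ) (u : ℝ) : ℝ := g (⌊u / h⌋₊ * h)

lemma measurable_leftStep (hg : Measurable g) (h : ℝ) : Measurable (leftStep g h) := by
  unfold leftStep
  have : Measurable fun u : ℝ => (⌊u / h⌋₊ : ℝ) * h :=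
    ((measurable_from_top (f := fun n : ℕ => (n : ℝ))).comp
      (Nat.measurable_floor.comp (measurable_id.div_const h))).mul_const h
  exact hg.comp this

lemma integral_leftStep (hg : Measurable g) (hK : ∀ u, |g u| ≤ K) {h : ℝ} (hh : 0 < h) (j : ℕ) :
    ∫ u in (0 : ℝ)..(j * h), leftStep g h u = h * ∑ i ∈ Finset.range j, g (i * h) := by
  have hint := intervalIntegrable_of_abs_le (measurable_leftStep hg h) (K := K) (fun u => hK _)
  have := intervalIntegral.sum_integral_adjacent_intervals (f := leftStep g h) (μ := volume)
    (a := fun i : ℕ => (i : ℝ) * h) (n := j) (fun _ _ => hint _ _)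
  simp only [Nat.cast_zero, zero_mul] at this
  rw [← this, Finset.mul_sum]
  refine Finset.sum_congr rfl fun i _ => ?_
  have hle : (i : ℝ) * h ≤ ((i + 1 : ℕ) : ℝ) * h := by push_cast; nlinarith
  have e : ∫ u in (i * h : ℝ)..((i + 1 : ℕ) * h), leftStep g h u =
      ∫ u in (i * h : ℝ)..((i + 1 : ℕ) * h), g (i * h) := by
    refine intervalIntegral.integral_congr_ae ?_
    -- At the right end of the cell the floor jumps to `i + 1`; this single point is discarded.
    have hne : ∀ᵐ u : ℝ, u ≠ ((i + 1 : ℕ) : ℝ) * h := by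
      simp [ae_iff, measure_singleton]
    filter_upwards [hne] with u hu hmem
    rw [uIoc_of_le hle] at hmem
    have hfl : ⌊u / h⌋₊ = i := by
      rw [Nat.floor_eq_iff (div_nonneg ((by positivity : (0 : ℝ) ≤ i * h).trans hmem.1.le) hh.le),
        le_div_iff₀ hh, div_lt_iff₀ hh]
      refine ⟨hmem.1.le, lt_of_le_of_ne ?_ ?_⟩
      · exact_mod_cast hmem.2
      · exact_mod_cast hu
    rw [leftStep, hfl]
  rw [e, intervalIntegral.integral_const, smul_eq_mul]
  push_cast
  ring

/-- The Riemann sum is the integral of the step function, so the `L¹` distance on `[0, t]` bounds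
the error uniformly in `j`. -/
lemma abs_integral_sub_sum_le (hg : Measurable g) (hK : ∀ u, |g u| ≤ K) {h t : ℝ} (hh : 0 < h)
    {j : ℕ} (hj : j * h ≤ t) :
    |(∫ u in (0 : ℝ)..(j * h), g u) - h * ∑ i ∈ Finset.range j, g (i * h)| ≤
      ∫ u in (0 : ℝ)..t, |g u - leftStep g h u| := by
  have hj0 : (0 : ℝ) ≤ j * h := by positivity
  have h1 := intervalIntegrable_of_abs_le hg hK
  have h2 := intervalIntegrable_of_abs_le (measurable_leftStep hg h) (K := K) (fun u => hK _)
  rw [← integral_leftStep hg hK hh, ← intervalIntegral.integral_sub (h1 _ _) (h2 _ _)]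
  refine (intervalIntegral.abs_integral_le_integral_abs hj0).trans ?_
  refine intervalIntegral.integral_mono_interval le_rfl hj0 hj
    (ae_of_all _ fun u => abs_nonneg _) ((h1 _ _).sub (h2 _ _)).abs

lemma tendsto_leftStep {h : ℕ → ℝ} (hpos : ∀ m, 0 < h m) (hlim : Tendsto h atTop (𝓝 0)) {u : ℝ}
    (hu : 0 ≤ u) (hcont : ContinuousAt g u) :
    Tendsto (fun m => leftStep g (h m) u) atTop (𝓝 (g u)) := by
  refine hcont.tendsto.comp ?_
  refine tendsto_of_tendsto_of_tendsto_of_le_of_le (g := fun m => u - h m) (h := fun _ => u)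
    (by simpa using hlim.const_sub u) tendsto_const_nhds (fun m => ?_) (fun m => ?_)
  · have := Nat.lt_floor_add_one (u / h m)
    rw [div_lt_iff₀ (hpos m)] at this
    dsimp only
    linarith
  · have := Nat.floor_le (div_nonneg hu (hpos m).le)
    rwa [le_div_iff₀ (hpos m)] at this

lemma tendsto_integral_abs_sub_leftStep (hg : Measurable g) (hK : ∀ u, |g u| ≤ K)
    (hcont : ∀ᵐ u, ContinuousAt g u) {h : ℕ → ℝ} (hpos : ∀ m, 0 < h m)
    (hlim : Tendsto h atTop (𝓝 0)) {t : ℝ} (ht : 0 ≤ t) :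
    Tendsto (fun m => ∫ u in (0 : ℝ)..t, |g u - leftStep g (h m) u|) atTop (𝓝 0) := by
  have := intervalIntegral.tendsto_integral_filter_of_dominated_convergence (l := atTop)
    (μ := volume) (a := 0) (b := t) (F := fun m u => |g u - leftStep g (h m) u|) (f := fun _ => 0)
    (fun _ => 2 * K)
    (Eventually.of_forall fun m =>
      ((hg.sub (measurable_leftStep hg (h m))).abs).aestronglyMeasurable)
    (Eventually.of_forall fun m => ae_of_all _ fun u _ => by
      have h1 := hK u
      have h2 : |leftStep g (h m) u| ≤ K := hK _
      have h3 := abs_sub (g u) (leftStep g (h m) u)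
      rw [Real.norm_eq_abs, abs_abs]
      linarith)
    intervalIntegrable_const ?_
  · simpa using this
  · filter_upwards [hcont] with u hu hmem
    rw [uIoc_of_le ht] at hmem
    simpa using ((tendsto_leftStep hpos hlim hmem.1.le hu).const_sub (g u)).abs

end StepFunction

/-! ### Pathwise convergence of the grid maximum to the running maximum. -/

/-- The largest value at a point of the grid with `m + 1` cells on `[0, t]` of the telegraph process
whose velocity is frozen on each cell. -/
noncomputable def gridMax {Ω : Type*} (V : Ω → ℝ) (N : ℝ≥0 → Ω → ℕ) (t : ℝ≥0) (m : ℕ)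
    (ω : Ω) : ℝ :=
  (Finset.range (m + 2)).sup' (Finset.nonempty_range_iff.2 (Nat.succ_ne_zero _)) fun j =>
    ((t / (m + 1 : ℕ) : ℝ≥0) : ℝ) *
      ∑ i ∈ Finset.range j, V ω * (-1) ^ N (i * (t / (m + 1 : ℕ))) ω

section Path

variable {Ω : Type*} {V : Ω → ℝ} {N : ℝ≥0 → Ω → ℕ} {ω : Ω}

lemma measurable_velocity_path (hmono : Monotone fun t => N t ω) :
    Measurable fun u : ℝ => V ω * (-1 : ℝ) ^ N u.toNNReal ω := by
  have h1 : Measurable fun u : ℝ => N u.toNNReal ω :=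
    Monotone.measurable fun a b hab => hmono (Real.toNNReal_mono hab)
  exact ((measurable_from_top (f := fun k : ℕ => (-1 : ℝ) ^ k)).comp h1).const_mul _

lemma abs_velocity_path_le (u : ℝ) : |V ω * (-1 : ℝ) ^ N u.toNNReal ω| ≤ |V ω| := by
  simp [abs_mul]

lemma ae_continuousAt_velocity_path (hmono : Monotone fun t => N t ω) :
    ∀ᵐ u : ℝ, ContinuousAt (fun u : ℝ => V ω * (-1 : ℝ) ^ N u.toNNReal ω) u := by
  have h1 : Monotone fun u : ℝ => N u.toNNReal ω := fun a b hab => hmono (Real.toNNReal_mono hab)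
  filter_upwards [h1.countable_not_continuousAt.ae_notMem volume] with u hu
  have hu : ContinuousAt (fun u : ℝ => N u.toNNReal ω) u := by simpa using hu
  exact ((continuous_of_discreteTopology (f := fun k : ℕ => (-1 : ℝ) ^ k)).continuousAt.comp
    hu).const_mul _

lemma abs_telegraph_sub_le (hmono : Monotone fun t => N t ω) (s s' : ℝ≥0) :
    |telegraph V N s ω - telegraph V N s' ω| ≤ |V ω| * |(s : ℝ) - s'| := by
  have h1 := intervalIntegrable_of_abs_le (measurable_velocity_path (V := V) hmono)
    abs_velocity_path_le
  rw [telegraph, telegraph, intervalIntegral.integral_interval_sub_left (h1 _ _) (h1 _ _),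
    ← Real.norm_eq_abs]
  exact intervalIntegral.norm_integral_le_of_norm_le_const fun u _ => abs_velocity_path_le u

lemma continuous_telegraph (hmono : Monotone fun t => N t ω) :
    Continuous fun s => telegraph V N s ω := by
  refine LipschitzWith.continuous (K := ‖V ω‖₊) (LipschitzWith.of_dist_le_mul fun s s' => ?_)
  rw [Real.dist_eq, NNReal.dist_eq]
  exact abs_telegraph_sub_le hmono s s'

lemma isGreatest_runningMax_telegraph (hmono : Monotone fun t => N t ω) (t : ℝ≥0) :
    IsGreatest ((fun s => telegraph V N s ω) '' Icc 0 t) (runningMax (telegraph V N) t ω) :=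
  (isCompact_Icc.image (continuous_telegraph hmono)).isGreatest_sSup
    ((nonempty_Icc.2 (zero_le)).image _)

/-- At grid points the two paths differ by at most the `L¹` error. Moving a maximiser to the grid
point on its left costs at most `|V| h`, by the Lipschitz bound. -/
lemma abs_gridMax_sub_runningMax_le (hmono : Monotone fun t => N t ω) {t : ℝ≥0} (ht : 0 < t)
    (m : ℕ) :
    |gridMax V N t m ω - runningMax (telegraph V N) t ω| ≤
      (∫ u in (0 : ℝ)..t, |(V ω * (-1 : ℝ) ^ N u.toNNReal ω) -
        leftStep (fun u : ℝ => V ω * (-1 : ℝ) ^ N u.toNNReal ω) (t / (m + 1 : ℕ)) u|) +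
      |V ω| * (t / (m + 1 : ℕ)) := by
  set h : ℝ≥0 := t / (m + 1 : ℕ) with hdef
  have hpos : (0 : ℝ) < h := NNReal.coe_pos.2 (div_pos ht (by positivity))
  have hcoe : (h : ℝ) = (t : ℝ) / (m + 1 : ℕ) := by rw [hdef]; push_cast; rfl
  have hmul : ((m + 1 : ℕ) : ℝ) * h = t := by rw [hcoe]; field_simp
  rw [← hcoe]
  set g : ℝ → ℝ := fun u => V ω * (-1 : ℝ) ^ N u.toNNReal ω with hg
  set E : ℝ := ∫ u in (0 : ℝ)..t, |g u - leftStep g h u| with hE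
  have hgrid : ∀ j ≤ m + 1, |telegraph V N (j * h) ω -
      h * ∑ i ∈ Finset.range j, V ω * (-1) ^ N (i * h) ω| ≤ E := by
    intro j hj
    have hjt : (j : ℝ) * h ≤ t := by
      rw [← hmul]; exact mul_le_mul_of_nonneg_right (Nat.cast_le.2 hj) hpos.le
    have := abs_integral_sub_sum_le (measurable_velocity_path (V := V) hmono)
      abs_velocity_path_le hpos hjt
    have e : ∀ i : ℕ, ((i : ℝ) * h).toNNReal = i * h := fun i => by
      rw [← NNReal.coe_natCast, ← NNReal.coe_mul, Real.toNNReal_coe]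
    simp only [e] at this
    simpa [telegraph] using this
  have hG := isGreatest_runningMax_telegraph (V := V) hmono t
  have hVh : 0 ≤ |V ω| * h := by positivity
  rw [abs_le]
  constructor
  · obtain ⟨s, hs, hsM⟩ := hG.1
    dsimp only at hsM
    set j := ⌊(s : ℝ) / h⌋₊ with hj
    have hj1 : (j : ℝ) * h ≤ s := by
      have := Nat.floor_le (div_nonneg s.2 hpos.le)
      rwa [le_div_iff₀ hpos] at this
    have hj2 : (s : ℝ) < (j + 1) * h := by
      have := Nat.lt_floor_add_one ((s : ℝ) / h)
      rwa [div_lt_iff₀ hpos] at this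
    have hst : (s : ℝ) ≤ t := NNReal.coe_le_coe.2 hs.2
    have hjm : j ≤ m + 1 := by
      have : (j : ℝ) * h ≤ ((m + 1 : ℕ) : ℝ) * h := by rw [hmul]; linarith
      exact Nat.cast_le.1 (le_of_mul_le_mul_right this hpos)
    have h1 := hgrid j hjm
    have h2 := abs_telegraph_sub_le (V := V) hmono s (j * h)
    have h3 : |(s : ℝ) - ((j * h : ℝ≥0) : ℝ)| ≤ h := by
      push_cast
      rw [abs_le]; constructor <;> linarith
    have h4 := mul_le_mul_of_nonneg_left h3 (abs_nonneg (V ω))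
    have h5 : h * ∑ i ∈ Finset.range j, V ω * (-1) ^ N (i * h) ω ≤ gridMax V N t m ω :=
      Finset.le_sup' (fun j : ℕ => (h : ℝ) * ∑ i ∈ Finset.range j, V ω * (-1) ^ N (i * h) ω)
        (Finset.mem_range.2 (by omega))
    rw [abs_le] at h1 h2
    linarith [h1.1, h1.2, h2.1, h2.2]
  · rw [sub_le_iff_le_add]
    refine Finset.sup'_le _ _ fun j hj => ?_
    have hjm : j ≤ m + 1 := by simp at hj; omega
    have hle : (j : ℝ≥0) * h ≤ t := by
      rw [← NNReal.coe_le_coe]; push_cast; rw [← hmul]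
      exact mul_le_mul_of_nonneg_right (Nat.cast_le.2 hjm) hpos.le
    have h1 := hgrid j hjm
    have h2 := hG.2 ⟨(j : ℝ≥0) * h, ⟨zero_le, hle⟩, rfl⟩
    dsimp only at h2
    rw [abs_le] at h1
    linarith [h1.1]

lemma tendsto_div_nat_succ (t : ℝ) : Tendsto (fun m : ℕ => t / (m + 1 : ℕ)) atTop (𝓝 0) :=
  (tendsto_const_div_atTop_nhds_zero_nat t).comp (tendsto_add_atTop_nat 1)

lemma tendsto_gridMax (hmono : Monotone fun t => N t ω) {t : ℝ≥0} (ht : 0 < t) :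
    Tendsto (fun m => gridMax V N t m ω) atTop (𝓝 (runningMax (telegraph V N) t ω)) := by
  have h1 := tendsto_integral_abs_sub_leftStep (measurable_velocity_path (V := V) hmono)
    abs_velocity_path_le (ae_continuousAt_velocity_path hmono)
    (h := fun m : ℕ => (t : ℝ) / (m + 1 : ℕ))
    (fun m => div_pos (NNReal.coe_pos.2 ht) (by positivity)) (tendsto_div_nat_succ t) t.2
  rw [tendsto_iff_dist_tendsto_zero]
  simp only [Real.dist_eq]
  refine squeeze_zero (fun _ => abs_nonneg _) (abs_gridMax_sub_runningMax_le hmono ht) ?_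
  have h2 := h1.add ((tendsto_div_nat_succ t).const_mul |V ω|)
  rw [mul_zero, add_zero] at h2
  exact h2

lemma runningMax_telegraph_nonneg (hmono : Monotone fun t => N t ω) (t : ℝ≥0) :
    0 ≤ runningMax (telegraph V N) t ω := by
  have := (isGreatest_runningMax_telegraph (V := V) hmono t).2 ⟨0, ⟨le_rfl, zero_le⟩, rfl⟩
  simpa [telegraph] using this

lemma measurable_gridMax [MeasurableSpace Ω] (hV : Measurable V) (hN : ∀ t, Measurable (N t))
    (t : ℝ≥0) (m : ℕ) : Measurable (gridMax V N t m) := by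
  have e : gridMax V N t m = (Finset.range (m + 2)).sup'
      (Finset.nonempty_range_iff.2 (Nat.succ_ne_zero _)) fun j ω =>
    ((t / (m + 1 : ℕ) : ℝ≥0) : ℝ) *
      ∑ i ∈ Finset.range j, V ω * (-1) ^ N (i * (t / (m + 1 : ℕ))) ω := by
    ext ω; rw [gridMax, Finset.sup'_apply]
  rw [e]
  refine Finset.measurable_sup' _ fun j _ => ?_
  refine (Finset.measurable_sum _ fun i _ => hV.mul ?_).const_mul _
  exact (measurable_from_top (f := fun k : ℕ => (-1 : ℝ) ^ k)).comp (hN _)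

/-- The increments before cell `i` sum to `N` at time `i h`, so the frozen path is `ch` times the
integer walk. -/
lemma gridMax_lt_iff {c : ℝ} (hc : 0 < c) (hV : V ω = -c) (h0 : N 0 ω = 0)
    (hmono : Monotone fun t => N t ω) {t : ℝ≥0} (ht : 0 < t) (m : ℕ) (J : ℤ) :
    gridMax V N t m ω < c * (t / (m + 1 : ℕ)) * J ↔
      ∀ j ≤ m + 1, turnWalk (-1) (fun l => gridIncr N (t / (m + 1 : ℕ)) l ω) j < J := by
  set h : ℝ≥0 := t / (m + 1 : ℕ) with hdef
  have hpos : (0 : ℝ) < h := NNReal.coe_pos.2 (div_pos ht (by positivity))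
  have hcoe : (t : ℝ) / (m + 1 : ℕ) = h := by rw [hdef]; push_cast; rfl
  have key : ∀ j, (h : ℝ) * ∑ i ∈ Finset.range j, V ω * (-1) ^ N (i * h) ω =
      c * h * (turnWalk (-1) (fun l => gridIncr N h l ω) j : ℤ) := by
    intro j
    simp only [turnWalk, sum_gridIncr h0 hmono, hV]
    push_cast
    simp only [← Finset.mul_sum]
    ring
  rw [gridMax, Finset.sup'_lt_iff]
  simp only [hcoe, ← hdef, key, Finset.mem_range,
    mul_lt_mul_iff_right₀ (mul_pos hc hpos), Int.cast_lt, ← Nat.lt_succ_iff]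

end Path

/-! ### Scaling limit of the count. -/

lemma tendsto_choose_mul_pow {k : ℕ → ℕ} {r : ℕ → ℝ} {s : ℝ}
    (hs : Tendsto (fun m => k m * r m) atTop (𝓝 s)) (hr : Tendsto r atTop (𝓝 0)) (i : ℕ) :
    Tendsto (fun m => ((k m).choose i : ℝ) * r m ^ i) atTop (𝓝 (s ^ i / i !)) := by
  induction i with
  | zero => simp
  | succ i ih =>
    have e : ∀ m, ((k m).choose (i + 1) : ℝ) * r m ^ (i + 1) =
        ((k m).choose i * r m ^ i) * (k m * r m - i * r m) / (i + 1) := by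
      intro m
      have h : ((k m).choose (i + 1) : ℝ) * (i + 1) = (k m).choose i * (k m - i) := by
        rcases le_or_gt i (k m) with hle | hlt
        · rw [← Nat.cast_sub hle]
          exact_mod_cast Nat.choose_succ_right_eq (k m) i
        · rw [Nat.choose_eq_zero_of_lt hlt, Nat.choose_eq_zero_of_lt (by omega)]
          simp
      rw [eq_div_iff (by positivity), pow_succ]
      linear_combination (r m ^ i * r m) * h
    simp only [e]
    convert (ih.mul (hs.sub (hr.const_mul (i : ℝ)))).div_const ((i : ℝ) + 1) using 2
    rw [Nat.factorial_succ]
    push_cast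
    field_simp
    ring

/-- The polynomial `∑ sign (i + 1 - j) * (x ^ i / i!) * (y ^ j / j!)` over `i + j = n`. -/
noncomputable def signedBinomial (n : ℕ) (x y : ℝ) : ℝ :=
  ∑ p ∈ Finset.HasAntidiagonal.antidiagonal n,
    (((p.1 : ℤ) + 1 - p.2).sign : ℝ) * (x ^ p.1 / (p.1)! * (y ^ p.2 / (p.2)!))

lemma continuous_signedBinomial (n : ℕ) {f g : ℝ → ℝ} (hf : Continuous f) (hg : Continuous g) :
    Continuous fun β => signedBinomial n (f β) (g β) := by
  unfold signedBinomial
  fun_prop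

/-- This homogeneity lets `(λt)^n` cancel against the Poisson weight, so the conditional law does
not depend on `λ`. -/
lemma signedBinomial_smul (n : ℕ) (a x y : ℝ) :
    signedBinomial n (a * x) (a * y) = a ^ n * signedBinomial n x y := by
  rw [signedBinomial, signedBinomial, Finset.mul_sum]
  refine Finset.sum_congr rfl fun p hp => ?_
  rw [← Finset.HasAntidiagonal.mem_antidiagonal.1 hp, mul_pow, mul_pow, pow_add]
  ring

lemma tendsto_signedVandermonde {k l : ℕ → ℕ} {r : ℕ → ℝ} {x y : ℝ}
    (hx : Tendsto (fun m => k m * r m) atTop (𝓝 x))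
    (hy : Tendsto (fun m => l m * r m) atTop (𝓝 y)) (hr : Tendsto r atTop (𝓝 0)) (n : ℕ) :
    Tendsto (fun m => r m ^ n * (signedVandermonde 1 (k m) (l m) n : ℝ)) atTop
      (𝓝 (signedBinomial n x y)) := by
  have e : ∀ m, r m ^ n * (signedVandermonde 1 (k m) (l m) n : ℝ) =
      ∑ p ∈ Finset.HasAntidiagonal.antidiagonal n, (((p.1 : ℤ) + 1 - p.2).sign : ℝ) *
        (((k m).choose p.1 * r m ^ p.1) * ((l m).choose p.2 * r m ^ p.2)) := by
    intro m
    rw [signedVandermonde]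
    push_cast
    rw [Finset.mul_sum]
    refine Finset.sum_congr rfl fun p hp => ?_
    rw [← Finset.HasAntidiagonal.mem_antidiagonal.1 hp, pow_add]
    ring
  simp only [e]
  exact tendsto_finsetSum _ fun p _ => ((tendsto_choose_mul_pow hx hr p.1).mul
    (tendsto_choose_mul_pow hy hr p.2)).const_mul _

/-! ### Comparing an event with the limit of approximating probabilities. -/

section MeasureLimits

variable {Ω : Type*} [MeasurableSpace Ω] {μ : Measure Ω}

/-- Fatou's lemma for sets: up to a null set, `E` lies in the increasing union of the tail
intersections of `D`. -/
lemma measure_le_of_eventually_mem {E : Set Ω} {D : ℕ → Set Ω} {a : ℝ≥0∞}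
    (h : ∀ᵐ ω ∂μ, ω ∈ E → ∀ᶠ m in atTop, ω ∈ D m)
    (hD : Tendsto (fun m => μ (D m)) atTop (𝓝 a)) : μ E ≤ a := by
  let B : ℕ → Set Ω := fun n => ⋂ m ≥ n, D m
  have hB : Monotone B := fun n n' hn =>
    subset_iInter₂ fun m hm => iInter₂_subset m (le_trans hn hm)
  have h1 : E ≤ᵐ[μ] (⋃ n, B n : Set Ω) := by
    filter_upwards [h] with ω hω hE
    obtain ⟨n, hn⟩ := eventually_atTop.1 (hω hE)
    exact mem_iUnion.2 ⟨n, mem_iInter₂.2 hn⟩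
  refine (measure_mono_ae h1).trans ?_
  exact le_of_tendsto_of_tendsto' (tendsto_measure_iUnion_atTop hB) hD fun n =>
    measure_mono (iInter₂_subset n le_rfl)

lemma measureReal_le_of_eventually_mem [IsFiniteMeasure μ] {E : Set Ω} {D : ℕ → Set Ω} {a : ℝ}
    (h : ∀ᵐ ω ∂μ, ω ∈ E → ∀ᶠ m in atTop, ω ∈ D m)
    (hD : Tendsto (fun m => μ.real (D m)) atTop (𝓝 a)) : μ.real E ≤ a := by
  have ha : 0 ≤ a := ge_of_tendsto' hD fun m => measureReal_nonneg
  refine ENNReal.toReal_le_of_le_ofReal ha (measure_le_of_eventually_mem h ?_)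
  simpa using ENNReal.tendsto_ofReal hD

lemma le_measureReal_of_eventually_notMem [IsProbabilityMeasure μ] {E : Set Ω} {D : ℕ → Set Ω}
    {a : ℝ} (hE : NullMeasurableSet E μ) (hDm : ∀ m, NullMeasurableSet (D m) μ)
    (h : ∀ᵐ ω ∂μ, ω ∉ E → ∀ᶠ m in atTop, ω ∉ D m)
    (hD : Tendsto (fun m => μ.real (D m)) atTop (𝓝 a)) : a ≤ μ.real E := by
  have := measureReal_le_of_eventually_mem (μ := μ) (E := Eᶜ) (D := fun m => (D m)ᶜ)
    (a := 1 - a) h (by simpa only [probReal_compl_eq_one_sub₀ (hDm _)] using hD.const_sub 1)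
  rw [probReal_compl_eq_one_sub₀ hE] at this
  linarith

end MeasureLimits

/-! ### The distribution function of the maximum on the conditioning event. -/

section Limit

variable {Ω : Type*} [MeasurableSpace Ω] {μ : Measure Ω} {lam : ℝ≥0} {N : ℝ≥0 → Ω → ℕ}
  {c : ℝ} {V : Ω → ℝ}

lemma IsTelegraphDriver.ae_tendsto_gridMax (hT : IsTelegraphDriver μ c lam V N) {t : ℝ≥0}
    (ht : 0 < t) :
    ∀ᵐ ω ∂μ, Tendsto (fun m => gridMax V N t m ω) atTop (𝓝 (runningMax (telegraph V N) t ω)) := by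
  filter_upwards [hT.poisson.paths] with ω hp using tendsto_gridMax hp.1 ht

lemma IsTelegraphDriver.aemeasurable_runningMax (hT : IsTelegraphDriver μ c lam V N) {t : ℝ≥0}
    (ht : 0 < t) : AEMeasurable (runningMax (telegraph V N) t) μ :=
  aemeasurable_of_tendsto_metrizable_ae atTop
    (fun m => (measurable_gridMax hT.measurable_velocity hT.poisson.measurable t m).aemeasurable)
    (hT.ae_tendsto_gridMax ht)

lemma IsTelegraphDriver.measurableSet_velocity_jumps (hT : IsTelegraphDriver μ c lam V N)
    (t : ℝ≥0) (n : ℕ) : MeasurableSet {ω | V ω = -c ∧ N t ω = n} :=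
  (hT.measurable_velocity (measurableSet_singleton _)).inter
    (hT.poisson.measurable t (measurableSet_singleton _))

lemma IsTelegraphDriver.measureReal_velocity_jumps (hT : IsTelegraphDriver μ c lam V N)
    (t : ℝ≥0) (n : ℕ) :
    μ.real {ω | V ω = -c ∧ N t ω = n} =
      1 / 2 * (Real.exp (-(lam * t)) * (lam * t) ^ n / n !) := by
  -- A grid with a single cell of length `t`: its increment is almost surely `N t`.
  have h1 := hT.measureReal_velocity_gridIncr_eq t 1 (fun _ => n)
  rw [Finset.prod_range_one] at h1
  rw [← h1]
  refine measureReal_congr ?_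
  filter_upwards [hT.poisson.start_zero] with ω h0
  refine propext ?_
  change (_ ∧ _) ↔ (_ ∧ ∀ l ∈ Finset.range 1, _)
  simp [gridIncr, h0]

variable [IsProbabilityMeasure μ]

lemma IsTelegraphDriver.tendsto_measureReal_gridMax_lt (hT : IsTelegraphDriver μ c lam V N)
    (hc : 0 < c) {t : ℝ≥0} (ht : 0 < t) (n : ℕ) {a b : ℕ → ℕ} (hab : ∀ m, a m + b m = m)
    (hba : ∀ m, b m ≤ a m) {x y : ℝ}
    (hx : Tendsto (fun m => a m * (lam * (t / (m + 1 : ℕ)) : ℝ)) atTop (𝓝 x))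
    (hy : Tendsto (fun m => b m * (lam * (t / (m + 1 : ℕ)) : ℝ)) atTop (𝓝 y)) :
    Tendsto (fun m => μ.real ({ω | V ω = -c ∧ N t ω = n} ∩
        {ω | gridMax V N t m ω < c * (t / (m + 1 : ℕ)) * ((a m : ℤ) + 1 - b m : ℤ)})) atTop
      (𝓝 (1 / 2 * Real.exp (-(lam * t)) * signedBinomial n x y)) := by
  have hr : Tendsto (fun m : ℕ => (lam * (t / (m + 1 : ℕ)) : ℝ)) atTop (𝓝 0) := by
    simpa using (tendsto_div_nat_succ t).const_mul (lam : ℝ)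
  have hmul : ∀ m : ℕ, ((m + 1 : ℕ) : ℝ≥0) * (t / (m + 1 : ℕ)) = t := fun m => by field_simp
  have hmain := (tendsto_signedVandermonde hx hy hr n).const_mul
    (1 / 2 * Real.exp (-(lam * t)))
  have herr : Tendsto (fun m : ℕ => (m : ℝ) * (lam * (t / (m + 1 : ℕ)) : ℝ) ^ 2 +
      (lam * (t / (m + 1 : ℕ)) : ℝ)) atTop (𝓝 0) := by
    -- Since `m = a m + b m`, the error is `(m r) r + r` with `m r` convergent and `r → 0`.
    have h1 := ((hx.add hy).mul hr).add hr
    rw [mul_zero, add_zero] at h1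
    refine h1.congr fun m => ?_
    have : (m : ℝ) = a m + b m := by exact_mod_cast (hab m).symm
    rw [this]
    ring
  refine tendsto_of_tendsto_of_dist hmain (squeeze_zero (fun _ => dist_nonneg) (fun m => ?_) herr)
  have h := hT.abs_measureReal_discreteBelow_sub_le (t / (m + 1 : ℕ)) m n ((a m : ℤ) + 1 - b m)
  have hcard := (card_turnsBelow_eq_signedVandermonde n (hab m) (hba m)).2
  have hcard' : ((turnsBelow (-1) m n ((a m : ℤ) + 1 - b m)).card : ℝ) =
    (signedVandermonde 1 (a m) (b m) n : ℝ) := by exact_mod_cast hcard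
  have hmul' : ((m + 1 : ℕ) : ℝ) * ((t / (m + 1 : ℕ) : ℝ≥0) : ℝ) = t := by
    exact_mod_cast congrArg NNReal.toReal (hmul m)
  have hset : μ.real (discreteBelow c V N (t / (m + 1 : ℕ)) m n ((a m : ℤ) + 1 - b m)) =
      μ.real ({ω | V ω = -c ∧ N t ω = n} ∩
        {ω | gridMax V N t m ω < c * (t / (m + 1 : ℕ)) * ((a m : ℤ) + 1 - b m : ℤ)}) := by
    refine measureReal_congr ?_
    filter_upwards [hT.poisson.start_zero, hT.poisson.paths] with ω h0 hp
    refine propext ?_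
    change ((V ω = -c ∧ N ((m + 1 : ℕ) * (t / (m + 1 : ℕ))) ω = n) ∧ _) ↔
      ((V ω = -c ∧ N t ω = n) ∧ _)
    rw [hmul]
    refine and_congr_right fun hA => ?_
    exact (gridMax_lt_iff hc hA.1 h0 hp.1 ht m _).symm
  rw [hset, hcard', hmul'] at h
  rw [dist_comm, Real.dist_eq]
  exact_mod_cast h

/-- If the maximum is strictly on one side of `β`, the grid maximum is eventually on that side of
the moving level, which tends to `β`. Equality is undecided, hence a strict and a weak inequality.
-/
lemma IsTelegraphDriver.measureReal_runningMax_bounds (hT : IsTelegraphDriver μ c lam V N)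
    (hc : 0 < c) {t : ℝ≥0} (ht : 0 < t) (n : ℕ) {β : ℝ} (hβ : 0 ≤ β) (hβt : β < c * t) :
    μ.real ({ω | V ω = -c ∧ N t ω = n} ∩ {ω | runningMax (telegraph V N) t ω < β}) ≤
        1 / 2 * Real.exp (-(lam * t)) * signedBinomial n (lam * t * ((c * t + β) / (2 * c * t)))
          (lam * t * ((c * t - β) / (2 * c * t))) ∧
      1 / 2 * Real.exp (-(lam * t)) * signedBinomial n (lam * t * ((c * t + β) / (2 * c * t)))
          (lam * t * ((c * t - β) / (2 * c * t))) ≤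
        μ.real ({ω | V ω = -c ∧ N t ω = n} ∩ {ω | runningMax (telegraph V N) t ω ≤ β}) := by
  have ht' : (0 : ℝ) < t := NNReal.coe_pos.2 ht
  set θ : ℝ := (c * t + β) / (2 * c * t) with hθ
  have hθ' : (c * t - β) / (2 * c * t) = 1 - θ := by rw [hθ]; field_simp; ring
  have hθ1 : 1 / 2 ≤ θ := by rw [hθ, div_le_div_iff₀ (by norm_num) (by positivity)]; linarith
  have hθ2 : θ < 1 := by rw [hθ, div_lt_one (by positivity)]; linarith
  -- The level is about `ch (2a - m)`, which tends to `ct (2θ - 1) = β`; `θ ≥ 1/2`, that is `β ≥ 0`,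
  -- ensures `b ≤ a`.
  let a : ℕ → ℕ := fun m => ⌊θ * (m + 1 : ℕ)⌋₊
  have ha1 : ∀ m, a m ≤ m := fun m => by
    refine Nat.lt_succ_iff.1 ((Nat.floor_lt (by positivity)).2 ?_)
    have : (0 : ℝ) < (m + 1 : ℕ) := by positivity
    push_cast at *
    nlinarith
  have ha2 : ∀ m, m - a m ≤ a m := fun m => by
    have h1 : θ * (m + 1 : ℕ) < a m + 1 := Nat.lt_floor_add_one _
    have h2 : ((m + 1 : ℕ) : ℝ) < 2 * a m + 2 := by
      have : (0 : ℝ) < (m + 1 : ℕ) := by positivity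
      nlinarith
    have h3 : m + 1 < 2 * a m + 2 := by exact_mod_cast h2
    omega
  have hlim : Tendsto (fun m : ℕ => (a m : ℝ) / (m + 1 : ℕ)) atTop (𝓝 θ) :=
    ((tendsto_nat_floor_mul_div_atTop (by linarith : 0 ≤ θ)).comp
      tendsto_natCast_atTop_atTop).comp (tendsto_add_atTop_nat 1)
  have hinv : Tendsto (fun m : ℕ => (1 : ℝ) / (m + 1 : ℕ)) atTop (𝓝 0) := tendsto_div_nat_succ 1
  have hlim2 : Tendsto (fun m : ℕ => ((m - a m : ℕ) : ℝ) / (m + 1 : ℕ)) atTop (𝓝 (1 - θ)) := by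
    have := (hinv.const_sub 1).sub hlim
    rw [sub_zero] at this
    refine this.congr fun m => ?_
    rw [Nat.cast_sub (ha1 m)]
    field_simp
    push_cast
    ring
  have hx : Tendsto (fun m => a m * (lam * (t / (m + 1 : ℕ)) : ℝ)) atTop (𝓝 (lam * t * θ)) :=
    (hlim.const_mul (lam * t : ℝ)).congr fun m => by ring
  have hy : Tendsto (fun m => ((m - a m : ℕ) : ℝ) * (lam * (t / (m + 1 : ℕ)) : ℝ)) atTop
      (𝓝 (lam * t * (1 - θ))) := (hlim2.const_mul (lam * t : ℝ)).congr fun m => by ring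
  have hlevel : Tendsto (fun m => c * (t / (m + 1 : ℕ)) * ((a m : ℤ) + 1 - (m - a m : ℕ) : ℤ))
      atTop (𝓝 β) := by
    have := ((hlim.add hinv).sub hlim2).const_mul (c * t)
    have e : c * t * (θ + 0 - (1 - θ)) = β := by rw [hθ]; field_simp; ring
    rw [e] at this
    refine this.congr fun m => ?_
    push_cast
    ring
  have hD := hT.tendsto_measureReal_gridMax_lt hc ht n (a := a) (b := fun m => m - a m)
    (fun m => Nat.add_sub_of_le (ha1 m)) ha2 hx hy
  rw [hθ']
  constructor
  · refine measureReal_le_of_eventually_mem ?_ hD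
    filter_upwards [hT.ae_tendsto_gridMax ht] with ω hω hE
    filter_upwards [hω.eventually_lt hlevel hE.2] with m hm using ⟨hE.1, hm⟩
  · have hA := hT.measurableSet_velocity_jumps t n
    refine le_measureReal_of_eventually_notMem (hA.nullMeasurableSet.inter
      (nullMeasurableSet_le (hT.aemeasurable_runningMax ht) aemeasurable_const))
      (fun m => (hA.inter (measurableSet_lt
        (measurable_gridMax hT.measurable_velocity hT.poisson.measurable t m)
        measurable_const)).nullMeasurableSet) ?_ hD
    filter_upwards [hT.ae_tendsto_gridMax ht] with ω hω hE
    by_cases hωA : V ω = -c ∧ N t ω = n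
    · have hM : β < runningMax (telegraph V N) t ω := by
        by_contra! hM
        exact hE ⟨hωA, hM⟩
      filter_upwards [hlevel.eventually_lt hω hM] with m hm hmem
      exact lt_asymm hm hmem.2
    · exact Eventually.of_forall fun m hmem => hωA hmem.1

lemma IsTelegraphDriver.measureReal_runningMax_le (hT : IsTelegraphDriver μ c lam V N)
    (hc : 0 < c) {t : ℝ≥0} (ht : 0 < t) (n : ℕ) {β : ℝ} (hβ : 0 ≤ β) (hβt : β < c * t) :
    μ.real ({ω | V ω = -c ∧ N t ω = n} ∩ {ω | runningMax (telegraph V N) t ω ≤ β}) =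
      1 / 2 * Real.exp (-(lam * t)) * signedBinomial n (lam * t * ((c * t + β) / (2 * c * t)))
          (lam * t * ((c * t - β) / (2 * c * t))) := by
  refine le_antisymm ?_ (hT.measureReal_runningMax_bounds hc ht n hβ hβt).2
  have hcont : Continuous fun β : ℝ => 1 / 2 * Real.exp (-(lam * t)) *
      signedBinomial n (lam * t * ((c * t + β) / (2 * c * t)))
          (lam * t * ((c * t - β) / (2 * c * t))) :=
    (continuous_signedBinomial n (by fun_prop) (by fun_prop)).const_mul _
  -- For `γ > β`, `P(M ≤ β) ≤ P(M < γ) ≤ F(γ)`; now let `γ` decrease to `β`.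
  refine ge_of_tendsto (hcont.continuousWithinAt (s := Ioi β) (x := β)) ?_
  filter_upwards [Ioo_mem_nhdsGT hβt] with γ hγ
  refine le_trans (measureReal_mono ?_)
    (hT.measureReal_runningMax_bounds hc ht n (hβ.trans hγ.1.le) hγ.2).1
  exact inter_subset_inter_right _ fun ω hω => lt_of_le_of_lt hω hγ.1

end Limit

/-! ### Derivative and special values of the limiting polynomial. -/

lemma hasDerivAt_pow_div_factorial {f : ℝ → ℝ} {f' x : ℝ} (hf : HasDerivAt f f' x) (i : ℕ) :
    HasDerivAt (fun β => f β ^ (i + 1) / (i + 1)!) (f' * (f x ^ i / i !)) x := by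
  refine ((hf.fun_pow (i + 1)).div_const ((i + 1)! : ℝ)).congr_deriv ?_
  rw [Nat.factorial_succ]
  push_cast
  field_simp

/-- Each divided power differentiates to the previous one. As the inner derivatives are opposite,
reindexing both halves by degree `n` leaves a difference of two signs whose arguments differ by `2`.
-/
lemma hasDerivAt_signedBinomial (n : ℕ) {f g : ℝ → ℝ} {a x : ℝ} (hf : HasDerivAt f a x)
    (hg : HasDerivAt g (-a) x) :
    HasDerivAt (fun β => signedBinomial (n + 1) (f β) (g β))
      (a * ∑ p ∈ Finset.HasAntidiagonal.antidiagonal n,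
        ((((p.1 : ℤ) + 2 - p.2).sign : ℝ) - (((p.1 : ℤ) - p.2).sign : ℝ)) *
          (f x ^ p.1 / (p.1)! * (g x ^ p.2 / (p.2)!))) x := by
  have hpow : ∀ {h : ℝ → ℝ} {h' : ℝ}, HasDerivAt h h' x → ∀ i : ℕ,
      HasDerivAt (fun β => h β ^ i / (i)!)
        (if i = 0 then 0 else h' * (h x ^ (i - 1) / (i - 1)!)) x := by
    intro h h' hh i
    cases i with
    | zero => simpa using hasDerivAt_const x (1 : ℝ)
    | succ i => simpa using hasDerivAt_pow_div_factorial hh i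
  have h1 := HasDerivAt.fun_sum (u := Finset.HasAntidiagonal.antidiagonal (n + 1)) (x := x)
    fun p _ => ((hpow hf p.1).fun_mul (hpow hg p.2)).const_mul (((p.1 : ℤ) + 1 - p.2).sign : ℝ)
  unfold signedBinomial
  refine h1.congr_deriv ?_
  simp only [mul_add, Finset.sum_add_distrib]
  rw [Finset.Nat.sum_antidiagonal_succ, Finset.Nat.sum_antidiagonal_succ', Finset.mul_sum]
  simp only [if_true, zero_mul, mul_zero, zero_add, Nat.add_eq_zero_iff, one_ne_zero, and_false,
    if_false, Nat.add_sub_cancel]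
  rw [← Finset.sum_add_distrib]
  refine Finset.sum_congr rfl fun p _ => ?_
  push_cast
  rw [show (p.1 : ℤ) + 1 + 1 - p.2 = p.1 + 2 - p.2 by ring,
    show (p.1 : ℤ) + 1 - (p.2 + 1) = p.1 - p.2 by ring]
  ring

/-- Here `i + j` is odd, so `i - j` is odd, and `i - j` and `i - j + 2` have different signs only
when `i - j = -1`. -/
lemma hasDerivAt_signedBinomial_even (k : ℕ) {f g : ℝ → ℝ} {a x : ℝ} (hf : HasDerivAt f a x)
    (hg : HasDerivAt g (-a) x) :
    HasDerivAt (fun β => signedBinomial (2 * (k + 1)) (f β) (g β))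
      (a * (2 * (f x ^ k / k ! * (g x ^ (k + 1) / (k + 1)!)))) x := by
  refine (hasDerivAt_signedBinomial (2 * k + 1) hf hg).congr_deriv ?_
  congr 1
  rw [Finset.sum_eq_single (k, k + 1)]
  · have h1 : ((k : ℤ) + 2 - (k + 1 : ℕ)).sign = 1 := Int.sign_eq_one_of_pos (by push_cast; omega)
    have h2 : ((k : ℤ) - (k + 1 : ℕ)).sign = -1 :=
      Int.sign_eq_neg_one_of_neg (by push_cast; omega)
    simp only [h1, h2]
    norm_num
  · rintro ⟨i, j⟩ hp hne
    have hij : i + j = 2 * k + 1 := Finset.HasAntidiagonal.mem_antidiagonal.1 hp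
    have hik : i ≠ k := fun h => hne (by ext <;> simp <;> omega)
    rcases lt_or_gt_of_ne hik with h | h
    · rw [Int.sign_eq_neg_one_of_neg (by simp only; omega),
        Int.sign_eq_neg_one_of_neg (by simp only; omega)]
      simp
    · rw [Int.sign_eq_one_of_pos (by simp only; omega),
        Int.sign_eq_one_of_pos (by simp only; omega)]
      simp
  · intro h
    exact absurd (Finset.HasAntidiagonal.mem_antidiagonal.2 (by simp only; omega)) h

lemma signedBinomial_one_zero (n : ℕ) : signedBinomial n 1 0 = 1 / n ! := by
  rw [signedBinomial, Finset.sum_eq_single (n, 0)]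
  · have : ((n : ℤ) + 1).sign = 1 := Int.sign_eq_one_of_pos (by omega)
    simp [this]
  · rintro ⟨i, j⟩ h1 h2
    rcases j with _ | j
    · simp_all
    · simp
  · simp

/-- Add the sum to its swapped copy: `i - j` is even, so for `i ≠ j` the signs of `i + 1 - j` and `j
+ 1 - i` are opposite. -/
lemma signedBinomial_even_self (k : ℕ) (x : ℝ) :
    signedBinomial (2 * k) x x = x ^ (2 * k) / (k ! * k !) := by
  have h : signedBinomial (2 * k) x x + signedBinomial (2 * k) x x =
      2 * (x ^ (2 * k) / (k ! * k !)) := by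
    conv_lhs =>
      enter [2]
      rw [signedBinomial, ← Finset.Nat.sum_antidiagonal_swap]
    rw [signedBinomial, ← Finset.sum_add_distrib, Finset.sum_eq_single (k, k)]
    · have : ((k : ℤ) + 1 - k).sign = 1 := Int.sign_eq_one_of_pos (by omega)
      simp only [Prod.swap_prod_mk, this]
      push_cast
      ring
    · rintro ⟨i, j⟩ hp hne
      have hij : i + j = 2 * k := Finset.HasAntidiagonal.mem_antidiagonal.1 hp
      have hik : i ≠ k := fun h => hne (by ext <;> simp <;> omega)
      simp only [Prod.swap_prod_mk]
      rcases lt_or_gt_of_ne hik with h | h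
      · rw [Int.sign_eq_neg_one_of_neg (show (i : ℤ) + 1 - j < 0 by omega),
          Int.sign_eq_one_of_pos (show 0 < (j : ℤ) + 1 - i by omega)]
        push_cast
        ring
      · rw [Int.sign_eq_one_of_pos (show 0 < (i : ℤ) + 1 - j by omega),
          Int.sign_eq_neg_one_of_neg (show (j : ℤ) + 1 - i < 0 by omega)]
        push_cast
        ring
    · intro h
      exact absurd (Finset.HasAntidiagonal.mem_antidiagonal.2 (by simp only; omega)) h
  linarith

/-- The conditional distribution function, on `[0, r]`, of the maximum up to the time at which the
fastest paths reach `r`, given a negative initial velocity and `n` jumps. -/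
noncomputable def maxCdf (n : ℕ) (r β : ℝ) : ℝ :=
  n ! * signedBinomial n ((r + β) / (2 * r)) ((r - β) / (2 * r))

lemma continuous_maxCdf (n : ℕ) (r : ℝ) : Continuous (maxCdf n r) :=
  (continuous_signedBinomial n (by fun_prop) (by fun_prop)).const_mul _

lemma maxCdf_self (n : ℕ) {r : ℝ} (hr : 0 < r) : maxCdf n r r = 1 := by
  have h1 : (r + r) / (2 * r) = 1 := by field_simp; ring
  rw [maxCdf, h1, sub_self, zero_div, signedBinomial_one_zero]
  field_simp

lemma maxCdf_even_zero (k : ℕ) {r : ℝ} (hr : 0 < r) :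
    maxCdf (2 * k) r 0 = (2 * k).choose k / 2 ^ (2 * k) := by
  have h1 : (r + 0) / (2 * r) = 1 / 2 := by field_simp; ring
  have h2 : (r - 0) / (2 * r) = 1 / 2 := by field_simp; ring
  have h3 : ((2 * k).choose k : ℝ) = (2 * k)! / (k ! * k !) := by
    rw [Nat.cast_choose ℝ (by omega : k ≤ 2 * k), show 2 * k - k = k by omega]
  rw [maxCdf, h1, h2, signedBinomial_even_self, h3, div_pow, one_pow]
  field_simp

/-- The conditional density of the maximum given a negative initial velocity and `2 * k` jumps. -/
noncomputable def maxDensity (k : ℕ) (r β : ℝ) : ℝ :=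
  2 * ((2 * k)! : ℝ) / ((k ! : ℝ) * ((k - 1)! : ℝ)) *
    ((r ^ 2 - β ^ 2) ^ (k - 1) * (r - β) / (2 * r) ^ (2 * k))

lemma continuous_maxDensity (k : ℕ) (r : ℝ) : Continuous (maxDensity k r) := by
  unfold maxDensity
  fun_prop

lemma maxDensity_nonneg (k : ℕ) {r β : ℝ} (hβ : β ∈ Ioo 0 r) : 0 ≤ maxDensity k r β := by
  have h1 : 0 ≤ r ^ 2 - β ^ 2 := by nlinarith [hβ.1, hβ.2]
  have h2 : 0 ≤ r - β := by linarith [hβ.2]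
  have h3 : 0 ≤ r := hβ.1.le.trans hβ.2.le
  unfold maxDensity
  positivity

lemma hasDerivAt_maxCdf {k : ℕ} (hk : 1 ≤ k) {r : ℝ} (hr : 0 < r) (β : ℝ) :
    HasDerivAt (maxCdf (2 * k) r) (maxDensity k r β) β := by
  obtain ⟨k, rfl⟩ : ∃ k', k = k' + 1 := ⟨k - 1, by omega⟩
  have hf : HasDerivAt (fun β : ℝ => (r + β) / (2 * r)) (1 / (2 * r)) β :=
    ((hasDerivAt_id β).const_add r).div_const _
  have hg : HasDerivAt (fun β : ℝ => (r - β) / (2 * r)) (-(1 / (2 * r))) β := by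
    rw [← neg_div]
    exact ((hasDerivAt_id β).const_sub r).div_const _
  refine ((hasDerivAt_signedBinomial_even k hf hg).const_mul _).congr_deriv ?_
  rw [maxDensity, Nat.add_sub_cancel, show r ^ 2 - β ^ 2 = (r + β) * (r - β) by ring, mul_pow,
    div_pow, div_pow, show 2 * (k + 1) = 1 + k + (k + 1) by ring, pow_add (2 * r), pow_add (2 * r),
    pow_one]
  field_simp
  ring

lemma lintegral_maxDensity {k : ℕ} (hk : 1 ≤ k) {r B : ℝ} (hr : 0 < r) (hB : 0 ≤ B) (hBr : B ≤ r) :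
    ∫⁻ β in Ioo 0 B, ENNReal.ofReal (maxDensity k r β) =
      ENNReal.ofReal (maxCdf (2 * k) r B - maxCdf (2 * k) r 0) := by
  rw [← intervalIntegral.integral_eq_sub_of_hasDerivAt
    (fun β _ => hasDerivAt_maxCdf hk hr β) ((continuous_maxDensity k r).intervalIntegrable _ _),
    intervalIntegral.integral_of_le hB, integral_Ioc_eq_integral_Ioo,
    ofReal_integral_eq_lintegral_ofReal]
  · exact ((continuous_maxDensity k r).integrableOn_Icc).mono_set Ioo_subset_Icc_self
  · filter_upwards [ae_restrict_mem measurableSet_Ioo] with β hβ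
    exact maxDensity_nonneg k ⟨hβ.1, hβ.2.trans_le hBr⟩

/-! ### The conditional law and the theorem. -/

section Law

variable {Ω : Type*} [MeasurableSpace Ω] {μ : Measure Ω} {lam : ℝ≥0}
  {N : ℝ≥0 → Ω → ℕ} {c : ℝ} {V : Ω → ℝ}

lemma IsTelegraphDriver.measure_velocity_jumps_ne_zero (hT : IsTelegraphDriver μ c lam V N)
    (hlam : 0 < lam) {t : ℝ≥0} (ht : 0 < t) (n : ℕ) : μ {ω | V ω = -c ∧ N t ω = n} ≠ 0 := by
  have h1 := hT.measureReal_velocity_jumps t n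
  have hl : (0 : ℝ) < lam := NNReal.coe_pos.2 hlam
  have ht' : (0 : ℝ) < t := NNReal.coe_pos.2 ht
  have h2 : 0 < μ.real {ω | V ω = -c ∧ N t ω = n} := by rw [h1]; positivity
  intro h
  rw [measureReal_def, h] at h2
  simp at h2

lemma IsTelegraphDriver.ae_cond_runningMax_nonneg (hT : IsTelegraphDriver μ c lam V N) (t : ℝ≥0)
    (n : ℕ) : ∀ᵐ ω ∂μ[| {ω | V ω = -c ∧ N t ω = n}], 0 ≤ runningMax (telegraph V N) t ω := by
  refine cond_absolutelyContinuous.ae_le ?_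
  filter_upwards [hT.poisson.paths] with ω hp using runningMax_telegraph_nonneg hp.1 t

variable [IsProbabilityMeasure μ]

lemma IsTelegraphDriver.cond_runningMax_le (hT : IsTelegraphDriver μ c lam V N) (hc : 0 < c)
    (hlam : 0 < lam) {t : ℝ≥0} (ht : 0 < t) (n : ℕ) {β : ℝ} (hβ : 0 ≤ β) (hβt : β < c * t) :
    μ[{ω | runningMax (telegraph V N) t ω ≤ β} | {ω | V ω = -c ∧ N t ω = n}] =
      ENNReal.ofReal (maxCdf n (c * t) β) := by
  have hl : (0 : ℝ) < lam := NNReal.coe_pos.2 hlam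
  have ht' : (0 : ℝ) < t := NNReal.coe_pos.2 ht
  have h1 := hT.measureReal_runningMax_le hc ht n hβ hβt
  rw [signedBinomial_smul] at h1
  have h2 := hT.measureReal_velocity_jumps t n
  rw [cond_apply (hT.measurableSet_velocity_jumps t n), ← ofReal_measureReal, ← ofReal_measureReal,
    ← ENNReal.ofReal_inv_of_pos, ← ENNReal.ofReal_mul, h1, h2, maxCdf, ← mul_assoc 2 c]
  · congr 1
    field_simp
  · rw [h2]; positivity
  · rw [h2]; positivity

lemma IsTelegraphDriver.cond_runningMax_eq_zero (hT : IsTelegraphDriver μ c lam V N) (hc : 0 < c)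
    (hlam : 0 < lam) {t : ℝ≥0} (ht : 0 < t) (n : ℕ) :
    μ[{ω | runningMax (telegraph V N) t ω = 0} | {ω | V ω = -c ∧ N t ω = n}] =
      ENNReal.ofReal (maxCdf n (c * t) 0) := by
  rw [← hT.cond_runningMax_le hc hlam ht n le_rfl (mul_pos hc (NNReal.coe_pos.2 ht))]
  refine measure_congr ?_
  filter_upwards [hT.ae_cond_runningMax_nonneg t n] with ω hω
  exact propext ⟨fun h => le_of_eq h, fun h => le_antisymm h hω⟩

/-- A law on the line is determined by its values on `Iic β`. Identifying the whole law, atom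
included, yields the density formula for every Borel set at once. -/
lemma IsTelegraphDriver.map_runningMax_eq (hT : IsTelegraphDriver μ c lam V N) (hc : 0 < c)
    (hlam : 0 < lam) {t : ℝ≥0} (ht : 0 < t) {k : ℕ} (hk : 1 ≤ k) :
    (μ[| {ω | V ω = -c ∧ N t ω = 2 * k}]).map (runningMax (telegraph V N) t) =
      ENNReal.ofReal (maxCdf (2 * k) (c * t) 0) • Measure.dirac 0 +
        (volume.restrict (Ioo 0 (c * t))).withDensity
          (fun β => ENNReal.ofReal (maxDensity k (c * t) β)) := by
  have hct : 0 < c * t := mul_pos hc (NNReal.coe_pos.2 ht)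
  have : IsProbabilityMeasure (μ[| {ω | V ω = -c ∧ N t ω = 2 * k}]) :=
    cond_isProbabilityMeasure (hT.measure_velocity_jumps_ne_zero hlam ht _)
  have hM : AEMeasurable (runningMax (telegraph V N) t) (μ[| {ω | V ω = -c ∧ N t ω = 2 * k}]) :=
    (hT.aemeasurable_runningMax ht).mono_ac cond_absolutelyContinuous
  have := Measure.isProbabilityMeasure_map hM
  set ρ := (μ[| {ω | V ω = -c ∧ N t ω = 2 * k}]).map (runningMax (telegraph V N) t) with hρ
  have hmap : ∀ β, ρ (Iic β) = μ[{ω | runningMax (telegraph V N) t ω ≤ β} |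
      {ω | V ω = -c ∧ N t ω = 2 * k}] := fun β =>
    Measure.map_apply_of_aemeasurable hM measurableSet_Iic
  have hΦ0 : 0 ≤ maxCdf (2 * k) (c * t) 0 := by rw [maxCdf_even_zero k hct]; positivity
  -- `B` stands for `β` truncated at `ct`, so that one computation serves both `β < ct` and `β ≥
  -- ct`.
  have htarget : ∀ B, 0 ≤ B → B ≤ c * t → ∀ β,
      (Iic β ∩ Ioo 0 (c * t) : Set ℝ) =ᵐ[volume] (Ioo 0 B : Set ℝ) →
      ENNReal.ofReal (maxCdf (2 * k) (c * t) 0) +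
        (volume.restrict (Ioo 0 (c * t))).withDensity
          (fun β => ENNReal.ofReal (maxDensity k (c * t) β)) (Iic β) =
      ENNReal.ofReal (maxCdf (2 * k) (c * t) B) := by
    intro B hB hBr β hset
    have hmono : maxCdf (2 * k) (c * t) 0 ≤ maxCdf (2 * k) (c * t) B := by
      have := intervalIntegral.integral_nonneg_of_ae_restrict (μ := volume)
        (f := maxDensity k (c * t)) hB (by
          rw [Filter.EventuallyLE, ae_restrict_congr_set Ioo_ae_eq_Icc.symm]
          filter_upwards [ae_restrict_mem measurableSet_Ioo] with β hβ
          exact maxDensity_nonneg k ⟨hβ.1, hβ.2.trans_le hBr⟩)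
      rw [intervalIntegral.integral_eq_sub_of_hasDerivAt (fun β _ => hasDerivAt_maxCdf hk hct β)
        ((continuous_maxDensity k _).intervalIntegrable _ _)] at this
      linarith
    rw [withDensity_apply _ measurableSet_Iic, Measure.restrict_restrict measurableSet_Iic,
      Measure.restrict_congr_set hset, lintegral_maxDensity hk hct hB hBr,
      ← ENNReal.ofReal_add hΦ0 (by linarith)]
    congr 1
    ring
  refine Measure.ext_of_Iic _ _ fun β => ?_
  rw [Measure.add_apply, Measure.smul_apply, Measure.dirac_apply' _ measurableSet_Iic, smul_eq_mul]
  rcases lt_or_ge β 0 with hneg | hnn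
  · have hset : Iic β ∩ Ioo 0 (c * t) = ∅ := by
      ext u; simp only [mem_inter_iff, mem_Iic, mem_Ioo, mem_empty_iff_false, iff_false]; intro h
      linarith [h.1, h.2.1]
    rw [withDensity_apply _ measurableSet_Iic, Measure.restrict_restrict measurableSet_Iic, hset,
      hmap, Set.indicator_of_notMem (by simpa using hneg)]
    simp only [Measure.restrict_empty, lintegral_zero_measure, mul_zero, add_zero]
    rw [← nonpos_iff_eq_zero, ← (ae_iff.1 (hT.ae_cond_runningMax_nonneg t (2 * k)))]
    exact measure_mono fun ω hω => not_le.2 (lt_of_le_of_lt hω hneg)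
  · rw [Set.indicator_of_mem (by simpa using hnn), Pi.one_apply, mul_one]
    rcases lt_or_ge β (c * t) with hlt | hge
    · rw [hmap, hT.cond_runningMax_le hc hlam ht _ hnn hlt]
      refine (htarget β hnn hlt.le β ?_).symm
      have : Iic β ∩ Ioo 0 (c * t) = Ioc 0 β := by
        ext u; simp only [mem_inter_iff, mem_Iic, mem_Ioo, mem_Ioc]
        exact ⟨fun h => ⟨h.2.1, h.1⟩, fun h => ⟨h.2, h.1, h.2.trans_lt hlt⟩⟩
      rw [this]
      exact Ioo_ae_eq_Ioc.symm
    · rw [htarget (c * t) hct.le le_rfl β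
        (by rw [inter_eq_right.2 fun u hu => (hu.2.trans_le hge).le]; exact ae_eq_rfl),
        maxCdf_self _ hct]
      -- No bound on the paths is needed: the distribution function tends to `1` as `γ` increases to
      -- `ct`.
      refine le_antisymm (by simpa using prob_le_one) ?_
      rw [← maxCdf_self (2 * k) hct]
      have hlim : Tendsto (fun γ => ENNReal.ofReal (maxCdf (2 * k) (c * t) γ)) (𝓝[<] (c * t))
          (𝓝 (ENNReal.ofReal (maxCdf (2 * k) (c * t) (c * t)))) :=
        ENNReal.tendsto_ofReal (continuous_maxCdf _ _).continuousWithinAt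
      refine le_of_tendsto hlim ?_
      filter_upwards [Ioo_mem_nhdsLT hct] with γ hγ
      rw [← hT.cond_runningMax_le hc hlam ht _ hγ.1.le hγ.2, ← hmap]
      exact measure_mono (Iic_subset_Iic.2 (hγ.2.le.trans hge))

end Law

theorem mainTheorem3 {Ω : Type*} [MeasurableSpace Ω] (μ : Measure Ω) [IsProbabilityMeasure μ]
    (c : ℝ) (hc : 0 < c) (lam : ℝ≥0) (hlam : 0 < lam)
    (V : Ω → ℝ) (N : ℝ≥0 → Ω → ℕ) (hT : IsTelegraphDriver μ c lam V N)
    (t : ℝ≥0) (ht : 0 < t) (k : ℕ) :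
    -- the supremum is almost surely an attained maximum, and it is a random variable
    (∀ᵐ ω ∂μ, IsGreatest ((fun s => telegraph V N s ω) '' Icc 0 t)
      (runningMax (telegraph V N) t ω)) ∧
    AEMeasurable (runningMax (telegraph V N) t) μ ∧
    -- the conditional density on `(0, ct)`
    (1 ≤ k → ∀ B : Set ℝ, MeasurableSet B → B ⊆ Ioo 0 (c * t) →
      μ[{ω | runningMax (telegraph V N) t ω ∈ B} | {ω | V ω = -c ∧ N t ω = 2 * k}] =
        ∫⁻ β in B, ENNReal.ofReal
          (2 * ((2 * k)! : ℝ) / ((k ! : ℝ) * ((k - 1)! : ℝ)) *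
            ((c ^ 2 * (t : ℝ) ^ 2 - β ^ 2) ^ (k - 1) * (c * t - β) / (2 * c * t) ^ (2 * k)))) ∧
    -- the conditional atom at `0`
    μ[{ω | runningMax (telegraph V N) t ω = 0} | {ω | V ω = -c ∧ N t ω = 2 * k}] =
      ENNReal.ofReal (((2 * k).choose k : ℝ) / 2 ^ (2 * k)) := by
  have hct : 0 < c * t := mul_pos hc (NNReal.coe_pos.2 ht)
  refine ⟨?_, hT.aemeasurable_runningMax ht, fun hk B hB hBsub => ?_, ?_⟩
  · filter_upwards [hT.poisson.paths] with ω hp using isGreatest_runningMax_telegraph hp.1 t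
  · have hM : AEMeasurable (runningMax (telegraph V N) t)
        (μ[| {ω | V ω = -c ∧ N t ω = 2 * k}]) :=
      (hT.aemeasurable_runningMax ht).mono_ac cond_absolutelyContinuous
    have h0 : (0 : ℝ) ∉ B := fun h => lt_irrefl _ (hBsub h).1
    have h1 := congrArg (fun ρ : Measure ℝ => ρ B) (hT.map_runningMax_eq hc hlam ht hk)
    simp only [Measure.map_apply_of_aemeasurable hM hB, Measure.add_apply, Measure.smul_apply,
      Measure.dirac_apply' _ hB, Set.indicator_of_notMem h0, smul_zero, zero_add,
      withDensity_apply _ hB, Measure.restrict_restrict hB, inter_eq_left.2 hBsub] at h1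
    refine Eq.trans h1 (lintegral_congr fun β => ?_)
    rw [maxDensity, mul_pow, ← mul_assoc 2 c]
  · rw [hT.cond_runningMax_eq_zero hc hlam ht (2 * k), maxCdf_even_zero k hct]
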